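/- Fix $a\in(0,1/4]$ and let $g:(0,1]\to[0,\infty)$ be a measurable function such that $\sup_{0<x\le 1}x\,g(x)<\infty$; the restriction of $g$ to $[a,1]$ is piecewise $C^2$ (that is, $[a,1]$ can be partitioned into finitely many subintervals such that $g$ is $C^2$ on the interior of each of them and $g,g',g''$ have finite one-sided limits at their endpoints); and, for some $\epsilon>0$, $g(x)\ge\epsilon$ for all $x\in[1-\epsilon,1]\cap(0,1]$. The integral $\int_0^1 g(x)\,dx$ may be finite or infinite. Put $$C(\theta)=\int_0^1(e^{\theta x}-1)\,g(x)\,dx\qquad(\theta\in\mathbb R),$$ and let $T$ be a real random variable that has the infinitely divisible law with Lévy measure $g(x)\,dx$ on $(0,1]$, that is, $\mathbb E\,e^{\theta T}=e^{C(\theta)}$ for all $\theta\in\mathbb R$. Then for each $u>0$ there is exactly one real $\beta=\beta(u)$ with $C'(\beta)=u$; put $\sigma_\beta=\sqrt{C''(\beta)}$. Moreover, apart from a possible atom at $0$, the law of $T$ is absolutely continuous with a (possibly defective) density $f\ge 0$ that can be chosen continuous on $(1,\infty)$, and for each such choice of $f$, as $u\to\infty$, $$f(u)=\frac{e^{C(\beta)-u\beta}}{\sqrt{2\pi}\,\sigma_\beta}\left(1+O\!\left(\frac1{\sqrt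 u}\right)\right),$$ $$P(T\ge u)=\frac1\beta\cdot\frac{e^{C(\beta)-u\beta}}{\sqrt{2\pi}\,\sigma_\beta}\left(1+O\!\left(\frac1{\sqrt u}\right)\right),$$ and hence $$P(T\ge u)=\frac{f(u)}{\beta}\left(1+O\!\left(\frac1{\sqrt u}\right)\right).$$ -/

import Mathlib

/-- `g` is piecewise `C^k` on `[a, b]`: there is a partition `a = t 0 < ⋯ < t n = b` such that `g` is
`C^k` on the interior of each of the `n` subintervals, and `g` and its first `k` derivatives have
finite one-sided limits (from inside the subinterval) at the endpoints of each subinterval.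
The values of `g` at the points `t i` themselves are arbitrary. -/
def LevyTail.PiecewiseContDiff (k : ℕ) (g : ℝ → ℝ) (a b : ℝ) : Prop :=
  ∃ (n : ℕ) (t : Fin (n + 1) → ℝ), StrictMono t ∧ t 0 = a ∧ t (Fin.last n) = b ∧
    ∀ i : Fin n,
      ContDiffOn ℝ k g (Set.Ioo (t i.castSucc) (t i.succ)) ∧
      ∀ j : ℕ, j ≤ k →
        (∃ l : ℝ, Filter.Tendsto (iteratedDeriv j g)
          (nhdsWithin (t i.castSucc) (Set.Ioi (t i.castSucc))) (nhds l)) ∧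
        (∃ l : ℝ, Filter.Tendsto (iteratedDeriv j g)
          (nhdsWithin (t i.succ) (Set.Iio (t i.succ))) (nhds l))

/-- The cumulant generating function `C(θ) = ∫_(0,1] (e^{θ x} - 1) g(x) dx` attached to the
Lévy density `g` on `(0, 1]`. -/
noncomputable def LevyTail.cumulant (g : ℝ → ℝ) (θ : ℝ) : ℝ :=
  ∫ x in Set.Ioc (0 : ℝ) 1, (Real.exp (θ * x) - 1) * g x

/-- The random variable `T` has the infinitely divisible law with Lévy measure `g(x) dx` on `(0, 1]`:
`E e^{θ T} = exp (C(θ))` for all real `θ`. As the right-hand side is not `0`, the integrability of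
`e^{θ T}` is part of the condition. -/
def LevyTail.HasLevyDensity {Ω : Type*} [MeasurableSpace Ω] (T : Ω → ℝ)
    (P : MeasureTheory.Measure Ω) (g : ℝ → ℝ) : Prop :=
  ∀ θ : ℝ, ProbabilityTheory.mgf T P θ = Real.exp (LevyTail.cumulant g θ)

/-- `f` is a (possibly defective) density of the law `μ` on `ℝ`: apart from a possible atom at `0`,
the measure `μ` is absolutely continuous with density `f`. -/
def LevyTail.IsDefectiveDensity (μ : MeasureTheory.Measure ℝ) (f : ℝ → ℝ) : Prop :=
  Measurable f ∧ (∀ x, 0 ≤ f x) ∧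
    μ = μ {0} • MeasureTheory.Measure.dirac (0 : ℝ) +
      MeasureTheory.volume.withDensity (fun x => ENNReal.ofReal (f x))

/-- `F(u) = G(u) (1 + O(r(u)))` as `u → ∞`. -/
def LevyTail.EqWithRelError (F G r : ℝ → ℝ) : Prop :=
  ∃ R : ℝ → ℝ, Asymptotics.IsBigO Filter.atTop R r ∧
    ∀ᶠ u in Filter.atTop, F u = G u * (1 + R u)

/-- The approximation `e^{C(β) - u β} / (√(2 π) σ_β)` with `σ_β² = C''(β)`. -/
noncomputable def LevyTail.saddle (g : ℝ → ℝ) (β u : ℝ) : ℝ :=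
  Real.exp (LevyTail.cumulant g β - u * β) /
    (Real.sqrt (2 * Real.pi) * Real.sqrt (deriv (deriv (LevyTail.cumulant g)) β))

/-! ### Fourier inversion and Plancherel for bounded integrable functions. -/

namespace LevyTail

open MeasureTheory Filter Topology FourierTransform SchwartzMap
open scoped Convolution ENNReal ContDiff

/-! Put `k(x) = x g(x)`, a bounded function on `(0, 1]`, and `ν = k dx`. Then `C(θ) = ∫ (e^{θx} -
1)/x dν`, and `C'`, `C''` are the exponential moments of `ν` of orders 0 and 1. Since `C'` increases
strictly from 0 to infinity, the saddle point exists and is unique.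

Differentiating `E e^{zT} = e^{C(z)}` gives the size-bias identity `x μ(dx) = ν ∗ μ`
(`IsLevyLaw.withDensity_id_eq`). It produces the density: `x f(x) = ∫ k(x - y) dμ(y)`. The transform
of `ν ∗ μ` need not be integrable, so the identity is used twice. The density `G` of `ν ∗ ν ∗ μ`,
tilted by `e^{βx}`, has transform `K(β + it)² e^{C(β + it)}` with `K = C'`; by Plancherel `K` is
square integrable on vertical lines because `k` is bounded with bounded support. Hence `G` is given
by an absolutely convergent inversion integral (`IsLevyLaw.exp_mul_convDensityTwo_eq`). As `k` lives
on `(0, 1]`, `G(x)` lies between `(x - 1) x f(x)` and `x² f(x)` (`IsDefectiveDensity.mul_bounds`),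
so estimates for `G` pass to `f`.

The integral is evaluated by Laplace's method. For `|t| ≤ 1/4` a Taylor expansion gives the Gaussian
term. For `|t| ≥ 1/4` the mass of `k` near 1 makes `|e^{C(β + it) - C(β)}|` doubly exponentially
small in `β`, which beats the Plancherel bound of order `e^{2β}`. The result is a local estimate at
`u + y`, uniform in `y ≥ 0`, with `β` kept at the saddle point of `u`. Taking `y = 0` gives the
density; integrating against `e^{-βy}` gives the tail and its factor `1/β`. -/

theorem continuous_integral_sub_mul_of_bounded {f w : ℝ → ℝ} {M : ℝ} (hf : Measurable f)
    (hM : ∀ x, |f x| ≤ M) (hw : Integrable w) :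
    Continuous fun x => ∫ y, f (x - y) * w y := by
  have hfl : LocallyIntegrable f := by
    refine LocallyIntegrable.mono (g := f) (f := fun _ => M) (locallyIntegrable_const M)
      hf.aestronglyMeasurable (Eventually.of_forall fun x => ?_)
    simpa using (hM x).trans (le_abs_self M)
  have hM0 : 0 ≤ M := (abs_nonneg _).trans (hM 0)
  have hint : ∀ {v : ℝ → ℝ}, Integrable v → ∀ x, Integrable fun y => f (x - y) * v y := by
    intro v hv x
    exact hv.bdd_mul (c := M) (hf.comp (measurable_const.sub measurable_id)).aestronglyMeasurable
      (Eventually.of_forall fun y => hM _)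
  -- Since `f` is bounded, approximating `w` in `L¹` by continuous compactly supported functions
  -- approximates the convolution uniformly.
  refine continuous_of_uniform_approx_of_continuous fun s hs => ?_
  obtain ⟨e, he, hes⟩ := Metric.mem_uniformity_dist.1 hs
  obtain ⟨v, hvs, hv, hvc, hvi⟩ := hw.exists_hasCompactSupport_integral_sub_le
    (ε := e / (2 * (M + 1))) (by positivity)
  refine ⟨fun x => ∫ y, f (x - y) * v y, ?_, fun x => hes ?_⟩
  · have := hvs.continuous_convolution_right (ContinuousLinearMap.mul ℝ ℝ) hfl hvc
    rw [← MeasureTheory.convolution_flip] at this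
    convert this using 2 with x
    simp [convolution_def, mul_comm]
  · rw [Real.dist_eq, ← integral_sub (hint hw x) (hint hvi x)]
    calc |∫ y, (f (x - y) * w y - f (x - y) * v y)|
        ≤ ∫ y, |f (x - y) * w y - f (x - y) * v y| := abs_integral_le_integral_abs
      _ ≤ ∫ y, M * ‖w y - v y‖ := by
        refine integral_mono ((hint hw x).sub (hint hvi x)).abs
          ((hw.sub hvi).norm.const_mul M) fun y => ?_
        simp only [← mul_sub, abs_mul, Real.norm_eq_abs]
        exact mul_le_mul_of_nonneg_right (hM _) (abs_nonneg _)
      _ ≤ M * (e / (2 * (M + 1))) := by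
        rw [integral_const_mul]; exact mul_le_mul_of_nonneg_left hv hM0
      _ < e := by
        rw [mul_div_assoc', div_lt_iff₀ (by positivity)]; nlinarith

theorem continuous_fourier_of_integrable {q : ℝ → ℂ} (h1 : Integrable q) : Continuous (𝓕 q) :=
  VectorFourier.fourierIntegral_continuous Real.continuous_fourierChar continuous_inner h1

/-- Both transforms have the same pairing with every test function, because the transform can be
moved onto the test function in either setting. This makes the `L²` isometry available for the
integral transform. -/
theorem fourier_toLp_ae_eq {q : ℝ → ℂ} (h1 : Integrable q) (h2 : MemLp q 2) :
    ((𝓕 (h2.toLp q) : Lp (α := ℝ) ℂ 2) : ℝ → ℂ) =ᵐ[volume] 𝓕 q := by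
  have hc : Continuous (𝓕 q) := continuous_fourier_of_integrable h1
  refine ae_eq_of_integral_contDiff_smul_eq ?_ ?_ ?_
  · exact (Lp.memLp _).locallyIntegrable (by norm_num)
  · exact hc.locallyIntegrable
  · intro g hg hgs
    have hgs' : HasCompactSupport (Complex.ofRealCLM ∘ g) := hgs.comp_left rfl
    have hg' : ContDiff ℝ ∞ (Complex.ofRealCLM ∘ g) := by fun_prop
    let φ : 𝓢(ℝ, ℂ) := hgs'.toSchwartzMap hg'
    have e := DFunLike.congr_fun (Lp.fourier_toTemperedDistribution_eq (h2.toLp q)) φ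
    rw [TemperedDistribution.fourier_apply, Lp.toTemperedDistribution_apply,
      Lp.toTemperedDistribution_apply] at e
    have e2 : ∫ x, (𝓕 φ) x • (h2.toLp q) x = ∫ x, (𝓕 φ) x • q x := by
      refine integral_congr_ae ?_
      filter_upwards [h2.coeFn_toLp] with x hx
      rw [hx]
    have e3 : ∫ x, (𝓕 φ) x • q x = ∫ x, φ x • 𝓕 q x := by
      simpa using! VectorFourier.integral_fourierIntegral_smul_eq_flip (L := innerₗ ℝ)
        Real.continuous_fourierChar continuous_inner φ.integrable h1
    rw [e2, e3] at e
    simpa [φ] using e.symm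

theorem memLp_two_fourier {q : ℝ → ℂ} (h1 : Integrable q) (h2 : MemLp q 2) : MemLp (𝓕 q) 2 :=
  (memLp_congr_ae (fourier_toLp_ae_eq h1 h2)).1 (Lp.memLp _)

theorem integrable_norm_sq_fourier {q : ℝ → ℂ} (h1 : Integrable q) (h2 : MemLp q 2) :
    Integrable fun s => ‖𝓕 q s‖ ^ 2 :=
  (memLp_two_iff_integrable_sq_norm
    (continuous_fourier_of_integrable h1).aestronglyMeasurable).1 (memLp_two_fourier h1 h2)

theorem integral_norm_sq_fourier {q : ℝ → ℂ} (h1 : Integrable q) (h2 : MemLp q 2) :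
    ∫ s, ‖𝓕 q s‖ ^ 2 = ∫ x, ‖q x‖ ^ 2 := by
  have key : ∀ f : Lp (α := ℝ) ℂ 2, ∫ x, ‖f x‖ ^ 2 = ‖f‖ ^ 2 := by
    intro f
    have h := inner_self_eq_norm_sq_to_K (𝕜 := ℂ) f
    rw [MeasureTheory.L2.inner_def] at h
    have h' : ∫ x, ((‖f x‖ ^ 2 : ℝ) : ℂ) = ((‖f‖ ^ 2 : ℝ) : ℂ) := by
      simpa [inner_self_eq_norm_sq_to_K] using h
    rw [integral_complex_ofReal] at h'
    exact_mod_cast h'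
  let F : Lp (α := ℝ) ℂ 2 := 𝓕 (h2.toLp q)
  calc ∫ s, ‖𝓕 q s‖ ^ 2 = ∫ s, ‖F s‖ ^ 2 := by
        refine integral_congr_ae ?_
        filter_upwards [fourier_toLp_ae_eq h1 h2] with s hs
        rw [hs]
    _ = ∫ x, ‖h2.toLp q x‖ ^ 2 := by rw [key, key, Lp.norm_fourier_eq]
    _ = _ := by
        refine integral_congr_ae ?_
        filter_upwards [h2.coeFn_toLp] with s hs
        rw [hs]

/-- Fourier inversion for the convolution square of a bounded integrable function. -/
theorem integral_sub_mul_self_eq_fourier {q : ℝ → ℝ} {M : ℝ} (hq : Measurable q)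
    (hM : ∀ x, |q x| ≤ M) (hi : Integrable q) (h2 : MemLp (fun x => (q x : ℂ)) 2) (x : ℝ) :
    ((∫ y, q (x - y) * q y : ℝ) : ℂ) =
      ∫ s : ℝ, (𝓕 (fun x => (q x : ℂ)) s) ^ 2 * Complex.exp (2 * Real.pi * s * x * Complex.I) := by
  set Q : ℝ → ℂ := fun x => (q x : ℂ) with hQ
  have hQi : Integrable Q := hi.ofReal
  have hconv : (Q ⋆[ContinuousLinearMap.mul ℂ ℂ] Q) =
      fun x => ((∫ y, q (x - y) * q y : ℝ) : ℂ) := by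
    ext x
    rw [convolution_def, ← integral_complex_ofReal]
    simp [hQ, mul_comm]
  have hF : 𝓕 (Q ⋆[ContinuousLinearMap.mul ℂ ℂ] Q) = fun s => (𝓕 Q s) ^ 2 := by
    ext s
    rw [Real.fourier_mul_convolution_eq hQi hQi, sq]
  -- The reason for a convolution square: `𝓕 Q` is only known to be in `L²`, but its square is in
  -- `L¹`, as inversion requires.
  have hFi : Integrable fun s => (𝓕 Q s) ^ 2 := by
    rw [← integrable_norm_iff (by
      exact ((continuous_fourier_of_integrable hQi).pow 2).aestronglyMeasurable)]
    simpa using integrable_norm_sq_fourier hQi h2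
  have hcont : Continuous (Q ⋆[ContinuousLinearMap.mul ℂ ℂ] Q) := by
    rw [hconv]
    exact Complex.continuous_ofReal.comp (continuous_integral_sub_mul_of_bounded hq hM hi)
  have hinv := hcont.fourierInv_fourier_eq
    (hQi.integrable_convolution (ContinuousLinearMap.mul ℂ ℂ) hQi) (by rw [hF]; exact hFi)
  have := congrFun hinv x
  rw [hF, hconv] at this
  refine this.symm.trans ?_
  rw [Real.fourierInv_eq']
  refine integral_congr_ae (Eventually.of_forall fun s => ?_)
  simp only [smul_eq_mul, RCLike.inner_apply, conj_trivial, mul_comm]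
  congr 2
  push_cast
  ring

end LevyTail

/-! ### Exponential moments and cumulants of a finite measure on `(0, 1]`. -/

namespace LevyTail

open MeasureTheory Filter Topology FourierTransform SchwartzMap
open scoped Convolution ENNReal ContDiff

section Cumulant

open ProbabilityTheory

/-- The exponential moment `∫ xⁿ e^{β x} dν(x)`. -/
noncomputable def expMoment (ν : Measure ℝ) (n : ℕ) (β : ℝ) : ℝ :=
  ∫ x, x ^ n * Real.exp (β * x) ∂ν

/-- The complex cumulant function `∫ (e^{z x} - 1) / x dν(x)` of the Lévy measure `ν(dx) / x`. -/
noncomputable def complexCumulant (ν : Measure ℝ) (z : ℂ) : ℂ :=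
  ∫ x, (Complex.exp (z * x) - 1) / x ∂ν

variable {ν : Measure ℝ}

theorem integrable_of_bound_on_Ioc [IsFiniteMeasure ν] {E : Type*} [NormedAddCommGroup E]
    (hν : ∀ᵐ x ∂ν, x ∈ Set.Ioc (0 : ℝ) 1) {F : ℝ → E} (hF : AEStronglyMeasurable F ν) {B : ℝ}
    (hB : ∀ x ∈ Set.Ioc (0 : ℝ) 1, ‖F x‖ ≤ B) : Integrable F ν :=
  Integrable.of_bound hF B (hν.mono hB)

theorem exp_mul_le_exp_abs (β : ℝ) {x : ℝ} (hx : x ∈ Set.Ioc (0 : ℝ) 1) :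
    Real.exp (β * x) ≤ Real.exp |β| := by
  refine Real.exp_le_exp.2 ((le_abs_self _).trans ?_)
  rw [abs_mul, abs_of_pos hx.1]
  exact mul_le_of_le_one_right (abs_nonneg _) hx.2

theorem integrable_pow_mul_exp [IsFiniteMeasure ν] (hν : ∀ᵐ x ∂ν, x ∈ Set.Ioc (0 : ℝ) 1) (n : ℕ) (β : ℝ) :
    Integrable (fun x => x ^ n * Real.exp (β * x)) ν := by
  refine integrable_of_bound_on_Ioc hν (by fun_prop) (B := Real.exp |β|) fun x hx => ?_
  rw [Real.norm_eq_abs, abs_mul, Real.abs_exp, abs_pow, abs_of_pos hx.1]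
  exact (mul_le_of_le_one_left (Real.exp_pos _).le (pow_le_one₀ hx.1.le hx.2)).trans
    (exp_mul_le_exp_abs β hx)

theorem integrable_exp_mul_Ioc [IsFiniteMeasure ν] (hν : ∀ᵐ x ∂ν, x ∈ Set.Ioc (0 : ℝ) 1) (β : ℝ) :
    Integrable (fun x => Real.exp (β * x)) ν := by
  simpa using integrable_pow_mul_exp hν 0 β

theorem integrable_cexp_mul_Ioc [IsFiniteMeasure ν] (hν : ∀ᵐ x ∂ν, x ∈ Set.Ioc (0 : ℝ) 1) (z : ℂ) :
    Integrable (fun x : ℝ => Complex.exp (z * x)) ν := by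
  rw [← integrable_norm_iff (by fun_prop)]
  simpa [Complex.norm_exp] using integrable_exp_mul_Ioc hν z.re

theorem integrableExpSet_eq_univ [IsFiniteMeasure ν] (hν : ∀ᵐ x ∂ν, x ∈ Set.Ioc (0 : ℝ) 1) :
    integrableExpSet id ν = Set.univ :=
  Set.eq_univ_of_forall fun β => integrable_exp_mul_Ioc hν β

theorem hasDerivAt_expMoment [IsFiniteMeasure ν] (hν : ∀ᵐ x ∂ν, x ∈ Set.Ioc (0 : ℝ) 1) (n : ℕ) (β : ℝ) :
    HasDerivAt (expMoment ν n) (expMoment ν (n + 1) β) β :=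
  hasDerivAt_integral_pow_mul_exp_real (X := id)
    (by rw [integrableExpSet_eq_univ hν]; simp) n

theorem expMoment_nonneg (hν : ∀ᵐ x ∂ν, x ∈ Set.Ioc (0 : ℝ) 1) (n : ℕ) (β : ℝ) :
    0 ≤ expMoment ν n β :=
  integral_nonneg_of_ae (hν.mono fun _ hx => mul_nonneg (pow_nonneg hx.1.le _) (Real.exp_pos _).le)

theorem expMoment_succ_le [IsFiniteMeasure ν] (hν : ∀ᵐ x ∂ν, x ∈ Set.Ioc (0 : ℝ) 1) (n : ℕ) (β : ℝ) :
    expMoment ν (n + 1) β ≤ expMoment ν n β := by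
  refine integral_mono_ae (integrable_pow_mul_exp hν _ β) (integrable_pow_mul_exp hν _ β)
    (hν.mono fun x hx => ?_)
  exact mul_le_mul_of_nonneg_right (pow_le_pow_of_le_one hx.1.le hx.2 n.le_succ)
    (Real.exp_pos _).le

theorem complexMGF_ofReal_eq_expMoment (β : ℝ) :
    complexMGF id ν β = expMoment ν 0 β := by
  rw [complexMGF_ofReal]
  simp [mgf, expMoment]

/-- The numerator vanishes to first order at `x = 0`, which cancels the pole. So the cumulant is
finite even when `ν(dx)/x` has infinite mass. -/
theorem norm_cexp_sub_one_div_le (z : ℂ) {x : ℝ} (hx : x ∈ Set.Ioc (0 : ℝ) 1) :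
    ‖(Complex.exp (z * x) - 1) / x‖ ≤ ‖z‖ * Real.exp ‖z‖ := by
  have h := Complex.norm_exp_sub_sum_le_norm_mul_exp (z * x) 1
  simp only [Finset.sum_range_one, pow_zero, Nat.factorial_zero, Nat.cast_one, div_one,
    pow_one] at h
  have hxn : ‖(x : ℂ)‖ = x := by simp [abs_of_pos hx.1]
  rw [norm_div, hxn, div_le_iff₀ hx.1]
  refine h.trans ?_
  rw [norm_mul, hxn]
  have : Real.exp (‖z‖ * x) ≤ Real.exp ‖z‖ :=
    Real.exp_le_exp.2 (mul_le_of_le_one_right (norm_nonneg _) hx.2)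
  calc ‖z‖ * x * Real.exp (‖z‖ * x) ≤ ‖z‖ * x * Real.exp ‖z‖ :=
        mul_le_mul_of_nonneg_left this (mul_nonneg (norm_nonneg _) hx.1.le)
    _ = _ := by ring

theorem integrable_cexp_sub_one_div [IsFiniteMeasure ν] (hν : ∀ᵐ x ∂ν, x ∈ Set.Ioc (0 : ℝ) 1) (z : ℂ) :
    Integrable (fun x : ℝ => (Complex.exp (z * x) - 1) / x) ν :=
  integrable_of_bound_on_Ioc hν (Measurable.aestronglyMeasurable (by fun_prop))
    fun _ hx => norm_cexp_sub_one_div_le z hx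

theorem hasDerivAt_complexCumulant [IsFiniteMeasure ν] (hν : ∀ᵐ x ∂ν, x ∈ Set.Ioc (0 : ℝ) 1) (z : ℂ) :
    HasDerivAt (complexCumulant ν) (complexMGF id ν z) z := by
  have := hasDerivAt_integral_of_dominated_loc_of_deriv_le (μ := ν) (𝕜 := ℂ)
    (F := fun (w : ℂ) (x : ℝ) => (Complex.exp (w * x) - 1) / x)
    (F' := fun (w : ℂ) (x : ℝ) => Complex.exp (w * x)) (x₀ := z)
    (bound := fun _ => Real.exp (‖z‖ + 1)) (Metric.ball_mem_nhds z one_pos)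
    (Eventually.of_forall fun w => (integrable_cexp_sub_one_div hν w).aestronglyMeasurable)
    (integrable_cexp_sub_one_div hν z) (by fun_prop) ?_ (integrable_const _) ?_
  · simpa [complexMGF] using! this.2
  · filter_upwards [hν] with x hx w hw
    rw [Complex.norm_exp]
    refine Real.exp_le_exp.2 ((Complex.re_le_norm _).trans ?_)
    have hw' : ‖w‖ ≤ ‖z‖ + 1 := by
      have := norm_sub_norm_le w z
      rw [Metric.mem_ball, dist_eq_norm] at hw
      linarith
    rw [norm_mul, Complex.norm_real, Real.norm_eq_abs, abs_of_pos hx.1]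
    exact (mul_le_of_le_one_right (norm_nonneg _) hx.2).trans hw'
  · filter_upwards [hν] with x hx w hw
    have hx0 : (x : ℂ) ≠ 0 := by exact_mod_cast hx.1.ne'
    have h1 : HasDerivAt (fun w : ℂ => Complex.exp (w * x)) (Complex.exp (w * x) * (1 * x)) w :=
      ((hasDerivAt_id w).mul_const (x : ℂ)).cexp
    have h2 := (h1.sub_const 1).div_const (x : ℂ)
    rw [one_mul, mul_div_cancel_right₀ _ hx0] at h2
    exact h2

theorem complexCumulant_ofReal (θ : ℝ) :
    complexCumulant ν θ = ((∫ x, (Real.exp (θ * x) - 1) / x ∂ν : ℝ) : ℂ) := by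
  rw [complexCumulant, ← integral_complex_ofReal]
  simp

theorem norm_complexMGF_sub_expMoment_le [IsFiniteMeasure ν] (hν : ∀ᵐ x ∂ν, x ∈ Set.Ioc (0 : ℝ) 1) (β t : ℝ) :
    ‖complexMGF id ν (β + t * Complex.I) - expMoment ν 0 β‖ ≤ |t| * expMoment ν 1 β := by
  rw [← complexMGF_ofReal_eq_expMoment, complexMGF, complexMGF]
  simp only [id]
  rw [← integral_sub (integrable_cexp_mul_Ioc hν _) (integrable_cexp_mul_Ioc hν _), expMoment,
    ← integral_const_mul]
  refine norm_integral_le_of_norm_le ((integrable_pow_mul_exp hν _ _).const_mul _)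
    (hν.mono fun x hx => ?_)
  have : Complex.exp ((β + t * Complex.I) * x) - Complex.exp (β * x) =
      Complex.exp (β * x) * (Complex.exp (Complex.I * ((t * x : ℝ) : ℂ)) - 1) := by
    rw [mul_sub, ← Complex.exp_add, mul_one]
    push_cast
    ring_nf
  rw [this, norm_mul, Complex.norm_exp]
  have h2 : (β * x : ℂ).re = β * x := by simp
  rw [h2]
  have h3 := Real.norm_exp_I_mul_ofReal_sub_one_le (x := t * x)
  rw [Real.norm_eq_abs, abs_mul, abs_of_pos hx.1] at h3
  calc _ ≤ Real.exp (β * x) * (|t| * x) := mul_le_mul_of_nonneg_left h3 (Real.exp_pos _).le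
    _ = _ := by ring

theorem norm_complexMGF_le_expMoment (β t : ℝ) :
    ‖complexMGF id ν (β + t * Complex.I)‖ ≤ expMoment ν 0 β := by
  refine norm_complexMGF_le_mgf.trans ?_
  simp [mgf, expMoment]

/-- Second order Taylor expansion of the cumulant function on a vertical line. -/
theorem norm_complexCumulant_taylor_le [IsFiniteMeasure ν] (hν : ∀ᵐ x ∂ν, x ∈ Set.Ioc (0 : ℝ) 1) (β : ℝ) {t : ℝ}
    (ht : |t| ≤ 1) :
    ‖complexCumulant ν (β + t * Complex.I) - complexCumulant ν β
      - (t * expMoment ν 0 β * Complex.I - t ^ 2 / 2 * expMoment ν 1 β)‖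
      ≤ 2 / 9 * |t| ^ 3 * expMoment ν 0 β := by
  have e : complexCumulant ν (β + t * Complex.I) - complexCumulant ν β
      - (t * expMoment ν 0 β * Complex.I - t ^ 2 / 2 * expMoment ν 1 β) =
      ∫ x, ((Complex.exp ((β + t * Complex.I) * x) - 1) / x - (Complex.exp (β * x) - 1) / x
        - (t * Complex.I * ((x ^ 0 * Real.exp (β * x) : ℝ) : ℂ)
          - t ^ 2 / 2 * ((x ^ 1 * Real.exp (β * x) : ℝ) : ℂ))) ∂ν := by
    have h12 : Integrable (fun x : ℝ =>
        (Complex.exp ((β + t * Complex.I) * x) - 1) / x - (Complex.exp (β * x) - 1) / x) ν :=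
      (integrable_cexp_sub_one_div hν _).sub (integrable_cexp_sub_one_div hν _)
    have h3 : Integrable (fun x : ℝ =>
        t * Complex.I * ((x ^ 0 * Real.exp (β * x) : ℝ) : ℂ)) ν :=
      (integrable_pow_mul_exp hν _ _).ofReal.const_mul _
    have h4 : Integrable (fun x : ℝ =>
        (t ^ 2 / 2 : ℂ) * ((x ^ 1 * Real.exp (β * x) : ℝ) : ℂ)) ν :=
      (integrable_pow_mul_exp hν _ _).ofReal.const_mul _
    have h34 : Integrable (fun x : ℝ => t * Complex.I * ((x ^ 0 * Real.exp (β * x) : ℝ) : ℂ)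
        - t ^ 2 / 2 * ((x ^ 1 * Real.exp (β * x) : ℝ) : ℂ)) ν := h3.sub h4
    rw [integral_sub h12 h34,
      integral_sub (integrable_cexp_sub_one_div hν _) (integrable_cexp_sub_one_div hν _),
      integral_sub h3 h4, integral_const_mul, integral_const_mul, integral_complex_ofReal,
      integral_complex_ofReal]
    simp only [complexCumulant, expMoment]
    ring
  rw [e, expMoment, ← integral_const_mul]
  refine norm_integral_le_of_norm_le ((integrable_pow_mul_exp hν _ _).const_mul _)
    (hν.mono fun x hx => ?_)
  have hx0 : (x : ℂ) ≠ 0 := by exact_mod_cast hx.1.ne'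
  have hn : ‖(t * x * Complex.I : ℂ)‖ = |t| * x := by
    simp [abs_of_pos hx.1]
  have hn1 : ‖(t * x * Complex.I : ℂ)‖ ≤ 1 := by
    rw [hn]; exact (mul_le_of_le_one_right (abs_nonneg _) hx.2).trans ht
  -- The remainder is at most `|tx|³ · 4/(3! · 3) = (2/9)|tx|³`. One factor `x` cancels the `1/x`,
  -- and `x² ≤ 1` leaves the moment of order 0.
  have hb := Complex.exp_bound hn1 (n := 3) (by norm_num)
  have e2 : (Complex.exp ((β + t * Complex.I) * x) - 1) / x - (Complex.exp (β * x) - 1) / x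
        - (t * Complex.I * ((x ^ 0 * Real.exp (β * x) : ℝ) : ℂ)
          - t ^ 2 / 2 * ((x ^ 1 * Real.exp (β * x) : ℝ) : ℂ)) =
      ((Real.exp (β * x) / x : ℝ) : ℂ) * (Complex.exp (t * x * Complex.I)
        - ∑ m ∈ Finset.range 3, (t * x * Complex.I : ℂ) ^ m / m.factorial) := by
    have : Complex.exp ((β + t * Complex.I) * x) =
        Complex.exp (β * x) * Complex.exp (t * x * Complex.I) := by
      rw [← Complex.exp_add]; ring_nf
    rw [this]
    simp only [Finset.sum_range_succ, Finset.sum_range_zero, Nat.factorial]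
    push_cast
    field_simp
    ring_nf
    simp only [Complex.I_sq]
    ring
  rw [e2, norm_mul, Complex.norm_real, Real.norm_eq_abs,
    abs_of_pos (div_pos (Real.exp_pos _) hx.1)]
  rw [hn] at hb
  calc _ ≤ Real.exp (β * x) / x * ((|t| * x) ^ 3 * ((Nat.succ 3 : ℕ) * ((Nat.factorial 3 : ℕ) * (3 : ℕ) : ℝ)⁻¹)) :=
        mul_le_mul_of_nonneg_left hb (div_pos (Real.exp_pos _) hx.1).le
    _ = 2 / 9 * |t| ^ 3 * (x ^ 2 * Real.exp (β * x)) := by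
        have := hx.1.ne'
        simp [Nat.factorial]
        field_simp
        ring
    _ ≤ _ := by
        refine mul_le_mul_of_nonneg_left (mul_le_mul_of_nonneg_right ?_ (Real.exp_pos _).le)
          (by positivity)
        exact pow_le_pow_of_le_one hx.1.le hx.2 (by norm_num)

/-- The exact real part carries an extra weight `1/x`, which is at least 1 on `(0, 1]` and can be
dropped because `1 - cos ≥ 0`. -/
theorem re_complexCumulant_sub_le [IsFiniteMeasure ν] (hν : ∀ᵐ x ∂ν, x ∈ Set.Ioc (0 : ℝ) 1) (β t : ℝ) :
    (complexCumulant ν (β + t * Complex.I) - complexCumulant ν β).re ≤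
      -∫ x, (1 - Real.cos (t * x)) * Real.exp (β * x) ∂ν := by
  have hi1 := integrable_cexp_sub_one_div hν (β + t * Complex.I)
  have hi2 := integrable_cexp_sub_one_div hν β
  have hi12 : Integrable (fun x : ℝ =>
      (Complex.exp ((β + t * Complex.I) * x) - 1) / x - (Complex.exp (β * x) - 1) / x) ν :=
    hi1.sub hi2
  have hi3 : Integrable (fun x => (1 - Real.cos (t * x)) * Real.exp (β * x)) ν := by
    refine (integrable_exp_mul_Ioc hν β).bdd_mul (c := 2) (by fun_prop)
      (Eventually.of_forall fun x => ?_)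
    rw [Real.norm_eq_abs, abs_le]
    constructor <;> linarith [Real.neg_one_le_cos (t * x), Real.cos_le_one (t * x)]
  rw [complexCumulant, complexCumulant, ← integral_sub hi1 hi2, ← integral_neg,
    ← RCLike.re_eq_complex_re, ← integral_re hi12]
  refine integral_mono_ae hi12.re hi3.neg (hν.mono fun x hx => ?_)
  have e : (Complex.exp ((β + t * Complex.I) * x) - 1) / x - (Complex.exp (β * x) - 1) / x =
      ((1 / x * Real.exp (β * x) : ℝ) : ℂ) * (Complex.exp ((t * x : ℝ) * Complex.I) - 1) := by
    have : Complex.exp ((β + t * Complex.I) * x) =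
        Complex.exp (β * x) * Complex.exp ((t * x : ℝ) * Complex.I) := by
      rw [← Complex.exp_add]; push_cast; ring_nf
    rw [this]
    push_cast
    ring
  simp only [RCLike.re_eq_complex_re]
  rw [e, Complex.re_ofReal_mul, Complex.sub_re, Complex.exp_ofReal_mul_I_re, Complex.one_re]
  have h1 : 1 ≤ 1 / x := by rw [le_div_iff₀ hx.1]; linarith [hx.2]
  have h2 : 0 ≤ (1 - Real.cos (t * x)) * Real.exp (β * x) :=
    mul_nonneg (by linarith [Real.cos_le_one (t * x)]) (Real.exp_pos _).le
  nlinarith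

end Cumulant

end LevyTail

/-! ### Lévy kernels: decay off the real axis, moment comparison, the saddle point equation. -/

namespace LevyTail

open MeasureTheory Filter Topology FourierTransform SchwartzMap
open scoped Convolution ENNReal ContDiff

open ProbabilityTheory

/-- A measurable function `k`, bounded by `M`, supported on `(0, 1]` and at least `δ` on
`[1 - δ, 1]`; it plays the role of `x g(x)` for a Lévy density `g`. -/
structure IsLevyKernel (k : ℝ → ℝ) (M δ : ℝ) : Prop where
  measurable : Measurable k
  nonneg : ∀ x, 0 ≤ k x
  le : ∀ x, k x ≤ M
  eq_zero : ∀ x, x ∉ Set.Ioc (0 : ℝ) 1 → k x = 0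
  pos : 0 < δ
  le_quarter : δ ≤ 1 / 4
  ge : ∀ x ∈ Set.Icc (1 - δ) 1, δ ≤ k x

/-- The measure `k(x) dx`. -/
noncomputable def kernelMeasure (k : ℝ → ℝ) : Measure ℝ :=
  volume.withDensity fun x => ENNReal.ofReal (k x)

/-- By the sum-to-product formula the integral is at most `δ |sin y| / y` with `y = |t|δ/2 ≥ δ/8`,
and `|sin y| / y` stays away from 1 once `y` stays away from 0. -/
theorem exists_integral_cos_le {δ : ℝ} (hδ : 0 < δ) :
    ∃ ρ < 1, ∀ t : ℝ, 1 / 4 ≤ |t| → ∫ x in (1 - δ)..1, Real.cos (t * x) ≤ ρ * δ := by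
  -- For `y ≤ 2`, `sin y = 2 sin(y/2) cos(y/2) ≤ y cos(y/2)` with `y/2 ≥ δ/16`. For `y ≥ 2`, `|sin
  -- y| ≤ 1 ≤ y/2`. The cap 1 keeps the angle below `π/2`.
  have hc : Real.cos (min 1 (δ / 16)) < 1 := by
    have h0 : 0 < min 1 (δ / 16) := by positivity
    have := Real.cos_lt_cos_of_nonneg_of_le_pi_div_two le_rfl
      ((min_le_left _ _).trans (by linarith [Real.pi_gt_three])) h0
    rwa [Real.cos_zero] at this
  refine ⟨max (1 / 2) (Real.cos (min 1 (δ / 16))), max_lt (by norm_num) hc, fun t ht => ?_⟩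
  set ρ := max (1 / 2) (Real.cos (min 1 (δ / 16)))
  have ht0 : t ≠ 0 := by rintro rfl; norm_num at ht
  have htp : 0 < |t| := abs_pos.2 ht0
  have e : ∫ x in (1 - δ)..1, Real.cos (t * x) =
      2 * Real.sin (t * δ / 2) * Real.cos (t * (2 - δ) / 2) / t := by
    rw [intervalIntegral.integral_comp_mul_left (fun x => Real.cos x) ht0, integral_cos,
      Real.sin_sub_sin]
    simp only [smul_eq_mul]
    field_simp
    ring_nf
  have key : ∀ y, 0 < y → min 1 (δ / 16) ≤ y / 2 → |Real.sin y| ≤ ρ * y := by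
    intro y hy hy'
    rcases le_total y 2 with h | h
    · have h2 : Real.sin y = 2 * Real.sin (y / 2) * Real.cos (y / 2) := by
        rw [← Real.sin_two_mul]; ring_nf
      have hs : 0 ≤ Real.sin (y / 2) :=
        Real.sin_nonneg_of_nonneg_of_le_pi (by linarith) (by linarith [Real.pi_gt_three])
      have hs' : Real.sin (y / 2) ≤ y / 2 := Real.sin_le (by linarith)
      have hc0 : 0 ≤ Real.cos (y / 2) :=
        Real.cos_nonneg_of_mem_Icc ⟨by linarith [Real.pi_gt_three], by linarith [Real.pi_gt_three]⟩
      have hcl : Real.cos (y / 2) ≤ ρ :=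
        (Real.cos_le_cos_of_nonneg_of_le_pi (by positivity)
          (by linarith [Real.pi_gt_three]) hy').trans (le_max_right _ _)
      rw [h2, abs_of_nonneg (by positivity)]
      nlinarith [mul_le_mul hs' hcl hc0 (by linarith)]
    · have : 1 / 2 ≤ ρ := le_max_left _ _
      nlinarith [Real.abs_sin_le_one y]
  have h1 := key (|t| * δ / 2) (by positivity) ((min_le_right _ _).trans (by nlinarith))
  have h2 : |Real.sin (|t| * δ / 2)| = |Real.sin (t * δ / 2)| := by
    rcases abs_cases t with ⟨h, -⟩ | ⟨h, -⟩ <;> rw [h]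
    rw [show -t * δ / 2 = -(t * δ / 2) by ring, Real.sin_neg, abs_neg]
  rw [e]
  refine (le_abs_self _).trans ?_
  rw [abs_div, abs_mul, abs_mul, div_le_iff₀ htp, ← h2]
  have h3 := Real.abs_cos_le_one (t * (2 - δ) / 2)
  have h4 : |(2 : ℝ)| = 2 := by norm_num
  rw [h4]
  nlinarith [abs_nonneg (Real.sin (|t| * δ / 2)),
    mul_le_mul_of_nonneg_left h3 (abs_nonneg (Real.sin (|t| * δ / 2)))]

namespace IsLevyKernel

variable {k : ℝ → ℝ} {M δ : ℝ}

theorem bound_nonneg (hk : IsLevyKernel k M δ) : 0 ≤ M := (hk.nonneg 0).trans (hk.le 0)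

theorem abs_le (hk : IsLevyKernel k M δ) (x : ℝ) : |k x| ≤ M := by
  rw [abs_of_nonneg (hk.nonneg x)]; exact hk.le x

theorem integrable_mul (hk : IsLevyKernel k M δ) {F : ℝ → ℝ} (hF : Measurable F) {B : ℝ}
    (hB : ∀ x ∈ Set.Ioc (0 : ℝ) 1, |F x| ≤ B) : Integrable fun x => k x * F x := by
  have h : Integrable ((Set.Ioc (0 : ℝ) 1).indicator fun _ => M * B) :=
    (integrable_indicator_iff measurableSet_Ioc).2 (integrableOn_const (by simp))
  refine h.mono' (hk.measurable.mul hF).aestronglyMeasurable (Eventually.of_forall fun x => ?_)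
  by_cases hx : x ∈ Set.Ioc (0 : ℝ) 1
  · rw [Set.indicator_of_mem hx, Real.norm_eq_abs, abs_mul]
    exact mul_le_mul (hk.abs_le x) (hB x hx) (abs_nonneg _) hk.bound_nonneg
  · simp [hk.eq_zero x hx, Set.indicator_of_notMem hx]

theorem integrable (hk : IsLevyKernel k M δ) : Integrable k := by
  simpa using hk.integrable_mul (F := fun _ => 1) measurable_const (B := 1) (by simp)

theorem isFiniteMeasure (hk : IsLevyKernel k M δ) : IsFiniteMeasure (kernelMeasure k) :=
  isFiniteMeasure_withDensity_ofReal hk.integrable.2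

theorem ae_mem (hk : IsLevyKernel k M δ) :
    ∀ᵐ x ∂(kernelMeasure k), x ∈ Set.Ioc (0 : ℝ) 1 := by
  rw [kernelMeasure, ae_withDensity_iff hk.measurable.ennreal_ofReal]
  refine Eventually.of_forall fun x hx => ?_
  by_contra h
  simp [hk.eq_zero x h] at hx

theorem integral_eq {E : Type*} [NormedAddCommGroup E] [NormedSpace ℝ E]
    (hk : IsLevyKernel k M δ) (F : ℝ → E) :
    ∫ x, F x ∂(kernelMeasure k) = ∫ x, k x • F x := by
  rw [kernelMeasure, integral_withDensity_eq_integral_toReal_smul hk.measurable.ennreal_ofReal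
    (Eventually.of_forall fun x => ENNReal.ofReal_lt_top)]
  simp [ENNReal.toReal_ofReal, hk.nonneg]

theorem mul_intervalIntegral_le (hk : IsLevyKernel k M δ) {F : ℝ → ℝ} (hF : Continuous F)
    (h0 : ∀ x, 0 ≤ F x) :
    δ * ∫ x in (1 - δ)..1, F x ≤ ∫ x, F x ∂(kernelMeasure k) := by
  obtain ⟨B, hB⟩ := (isCompact_Icc (a := (0 : ℝ)) (b := 1)).exists_bound_of_continuousOn
    hF.continuousOn
  have hi : Integrable fun x => k x * F x :=
    hk.integrable_mul hF.measurable fun x hx => hB x ⟨hx.1.le, hx.2⟩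
  rw [hk.integral_eq, intervalIntegral.integral_of_le (by linarith [hk.pos]),
    ← integral_const_mul]
  calc ∫ x in Set.Ioc (1 - δ) 1, δ * F x ≤ ∫ x in Set.Ioc (1 - δ) 1, k x * F x := by
        refine setIntegral_mono_on ?_ hi.integrableOn measurableSet_Ioc fun x hx => ?_
        · exact ((continuous_const.mul hF).integrableOn_Icc).mono_set Set.Ioc_subset_Icc_self
        · exact mul_le_mul_of_nonneg_right (hk.ge x ⟨hx.1.le, hx.2⟩) (h0 x)
    _ ≤ ∫ x, k x • F x := by
        refine setIntegral_le_integral hi (Eventually.of_forall fun x => ?_)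
        exact mul_nonneg (hk.nonneg x) (h0 x)

theorem expMoment_zero_ge (hk : IsLevyKernel k M δ) {β : ℝ} (hβ : 0 ≤ β) :
    δ ^ 2 * Real.exp (β * (1 - δ)) ≤ expMoment (kernelMeasure k) 0 β := by
  have h := hk.mul_intervalIntegral_le (F := fun x => Real.exp (β * x)) (by fun_prop)
    fun x => (Real.exp_pos _).le
  have h2 : δ * Real.exp (β * (1 - δ)) ≤ ∫ x in (1 - δ)..1, Real.exp (β * x) := by
    have := intervalIntegral.integral_mono_on (μ := volume) (a := 1 - δ) (b := 1)
      (f := fun _ => Real.exp (β * (1 - δ))) (g := fun x => Real.exp (β * x))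
      (by linarith [hk.pos]) (by simp) ((by fun_prop : Continuous _).intervalIntegrable _ _)
      (fun x hx => Real.exp_le_exp.2 (mul_le_mul_of_nonneg_left hx.1 hβ))
    simpa using this
  simp only [expMoment, pow_zero, one_mul]
  nlinarith [hk.pos]

/-- On `[1 - δ, 1]` the kernel is at least `δ` and the tilt at least `e^{β(1 - δ)}`, while `1 -
cos(tx)` integrates there to at least `(1 - ρ)δ`. -/
theorem exists_norm_cexp_le (hk : IsLevyKernel k M δ) :
    ∃ κ > 0, ∀ β t : ℝ, 0 ≤ β → 1 / 4 ≤ |t| →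
      ‖Complex.exp (complexCumulant (kernelMeasure k) (β + t * Complex.I)
        - complexCumulant (kernelMeasure k) β)‖ ≤ Real.exp (-(κ * Real.exp (β * (1 - δ)))) := by
  obtain ⟨ρ, hρ, h⟩ := exists_integral_cos_le hk.pos
  have := hk.isFiniteMeasure
  refine ⟨δ * ((1 - ρ) * δ), by have := hk.pos; have : 0 < 1 - ρ := by linarith
                                positivity, fun β t hβ ht => ?_⟩
  rw [Complex.norm_exp]
  refine Real.exp_le_exp.2 ((re_complexCumulant_sub_le hk.ae_mem β t).trans (neg_le_neg ?_))
  have h0 : ∀ x, 0 ≤ 1 - Real.cos (t * x) := fun x => by linarith [Real.cos_le_one (t * x)]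
  refine le_trans ?_ (hk.mul_intervalIntegral_le (by fun_prop) fun x =>
    mul_nonneg (h0 x) (Real.exp_pos _).le)
  rw [mul_assoc]
  refine mul_le_mul_of_nonneg_left ?_ hk.pos.le
  have hcos : IntervalIntegrable (fun x => Real.cos (t * x)) volume (1 - δ) 1 :=
    (by fun_prop : Continuous _).intervalIntegrable _ _
  calc (1 - ρ) * δ * Real.exp (β * (1 - δ))
      ≤ (∫ x in (1 - δ)..1, (1 - Real.cos (t * x))) * Real.exp (β * (1 - δ)) := by
        refine mul_le_mul_of_nonneg_right ?_ (Real.exp_pos _).le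
        rw [intervalIntegral.integral_sub (by simp) hcos]
        simp only [intervalIntegral.integral_const, smul_eq_mul, mul_one]
        linarith [h t ht]
    _ ≤ _ := by
        rw [← intervalIntegral.integral_mul_const]
        refine intervalIntegral.integral_mono_on (by linarith [hk.pos])
          ((by fun_prop : Continuous _).intervalIntegrable _ _)
          ((by fun_prop : Continuous _).intervalIntegrable _ _) fun x hx => ?_
        exact mul_le_mul_of_nonneg_left
          (Real.exp_le_exp.2 (mul_le_mul_of_nonneg_left hx.1 hβ)) (h0 x)

/-- Split at `x = 1/2`: above it `1 ≤ 2x`, below it `e^{βx} ≤ e^{β/2}`, and the total mass of `k` is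
at most `M`. -/
theorem expMoment_zero_le_two_mul_add (hk : IsLevyKernel k M δ) {β : ℝ} (hβ : 0 ≤ β) :
    expMoment (kernelMeasure k) 0 β ≤
      2 * expMoment (kernelMeasure k) 1 β + M * Real.exp (β / 2) := by
  have := hk.isFiniteMeasure
  have hm : (kernelMeasure k).real Set.univ ≤ M := by
    have h1 : (kernelMeasure k).real Set.univ = ∫ x, k x := by
      have := hk.integral_eq (fun _ => (1 : ℝ))
      simpa using this
    rw [h1]
    have h2 : ∫ x, k x ≤ ∫ x, (Set.Ioc (0 : ℝ) 1).indicator (fun _ => M) x := by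
      refine integral_mono hk.integrable
        ((integrable_indicator_iff measurableSet_Ioc).2 (integrableOn_const (by simp)))
        fun x => ?_
      by_cases hx : x ∈ Set.Ioc (0 : ℝ) 1
      · simpa [Set.indicator_of_mem hx] using hk.le x
      · simp [hk.eq_zero x hx, Set.indicator_of_notMem hx]
    simpa [integral_indicator] using h2
  have hi := integrable_pow_mul_exp hk.ae_mem
  have hle : expMoment (kernelMeasure k) 0 β ≤ ∫ x, (2 * (x ^ 1 * Real.exp (β * x))
      + Real.exp (β / 2)) ∂(kernelMeasure k) := by
    refine integral_mono_ae (hi 0 β) (((hi 1 β).const_mul 2).add (integrable_const _))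
      (hk.ae_mem.mono fun x hx => ?_)
    simp only [pow_zero, one_mul, pow_one]
    rcases le_total x (1 / 2) with h | h
    · have : Real.exp (β * x) ≤ Real.exp (β / 2) := Real.exp_le_exp.2 (by nlinarith)
      have : 0 ≤ 2 * (x * Real.exp (β * x)) := by have := hx.1; positivity
      linarith
    · nlinarith [Real.exp_pos (β * x), Real.exp_pos (β / 2)]
  rw [integral_add ((hi 1 β).const_mul 2) (integrable_const _), integral_const_mul,
    integral_const, smul_eq_mul] at hle
  refine hle.trans (add_le_add le_rfl (mul_le_mul_of_nonneg_right hm (Real.exp_pos _).le))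

/-- The quarter of the first exponential moment bounds the second one from below for large `β`. -/
theorem eventually_expMoment_one_ge (hk : IsLevyKernel k M δ) :
    ∀ᶠ β in atTop, expMoment (kernelMeasure k) 0 β / 4 ≤ expMoment (kernelMeasure k) 1 β := by
  have h4 : Tendsto (fun β : ℝ => δ ^ 2 * Real.exp (β / 4)) atTop atTop :=
    (Real.tendsto_exp_atTop.comp (tendsto_id.atTop_div_const (by norm_num))).const_mul_atTop
      (by have := hk.pos; positivity)
  filter_upwards [eventually_ge_atTop 0, h4.eventually_ge_atTop (2 * M)] with β hβ h
  have h1 := hk.expMoment_zero_ge hβ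
  have h2 := hk.expMoment_zero_le_two_mul_add hβ
  -- Here `δ ≤ 1/4` matters: `1 - δ ≥ 1/2 + 1/4` leaves a spare factor `e^{β/4}` to absorb `2M`.
  -- With moments `u`, `v` of orders 0 and 1, `u ≤ 2v + u/2` follows.
  have h3 : 2 * M * Real.exp (β / 2) ≤ expMoment (kernelMeasure k) 0 β := by
    calc 2 * M * Real.exp (β / 2) ≤ δ ^ 2 * Real.exp (β / 4) * Real.exp (β / 2) :=
          mul_le_mul_of_nonneg_right h (Real.exp_pos _).le
      _ = δ ^ 2 * Real.exp (β / 4 + β / 2) := by rw [Real.exp_add]; ring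
      _ ≤ δ ^ 2 * Real.exp (β * (1 - δ)) := by
          refine mul_le_mul_of_nonneg_left (Real.exp_le_exp.2 ?_) (sq_nonneg _)
          nlinarith [hk.le_quarter]
      _ ≤ _ := h1
  linarith

theorem tendsto_expMoment_zero_atTop (hk : IsLevyKernel k M δ) :
    Tendsto (expMoment (kernelMeasure k) 0) atTop atTop := by
  have hδ := hk.pos
  have h4 : Tendsto (fun β : ℝ => δ ^ 2 * Real.exp (β * (1 - δ))) atTop atTop :=
    (Real.tendsto_exp_atTop.comp
      (tendsto_id.atTop_mul_const (by linarith [hk.le_quarter]))).const_mul_atTop (by positivity)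
  exact tendsto_atTop_mono' _ ((eventually_ge_atTop 0).mono fun β hβ => hk.expMoment_zero_ge hβ) h4

theorem expMoment_one_pos (hk : IsLevyKernel k M δ) (β : ℝ) :
    0 < expMoment (kernelMeasure k) 1 β := by
  have := hk.isFiniteMeasure
  refine (expMoment_nonneg hk.ae_mem 1 β).lt_of_ne fun h0 => ?_
  have h1 := (integral_eq_zero_iff_of_nonneg_ae (hk.ae_mem.mono fun x hx =>
    mul_nonneg (pow_nonneg hx.1.le 1) (Real.exp_pos _).le)
    (integrable_pow_mul_exp hk.ae_mem 1 β)).1 h0.symm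
  have h2 : ∀ᵐ x ∂(kernelMeasure k), False := by
    filter_upwards [h1, hk.ae_mem] with x hx hx'
    have : 0 < x ^ 1 * Real.exp (β * x) := by have := hx'.1; positivity
    exact this.ne' hx
  have h3 := hk.expMoment_zero_ge le_rfl
  have h4 : expMoment (kernelMeasure k) 0 0 = 0 :=
    integral_eq_zero_of_ae (h2.mono fun x hx => hx.elim)
  rw [h4, zero_mul, Real.exp_zero] at h3
  nlinarith [hk.pos]

theorem strictMono_expMoment_zero (hk : IsLevyKernel k M δ) :
    StrictMono (expMoment (kernelMeasure k) 0) := by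
  have := hk.isFiniteMeasure
  exact strictMono_of_hasDerivAt_pos (fun β => hasDerivAt_expMoment hk.ae_mem 0 β)
    fun β => hk.expMoment_one_pos β

theorem tendsto_expMoment_zero_atBot (hk : IsLevyKernel k M δ) :
    Tendsto (expMoment (kernelMeasure k) 0) atBot (𝓝 0) := by
  have := hk.isFiniteMeasure
  have h := tendsto_integral_filter_of_dominated_convergence (μ := kernelMeasure k) (l := atBot)
    (F := fun (β : ℝ) x => x ^ 0 * Real.exp (β * x)) (f := fun _ => 0) (fun _ => 1)
    (Eventually.of_forall fun β => by fun_prop) ?_ (integrable_const _) ?_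
  · rw [integral_zero] at h
    exact h
  · filter_upwards [eventually_le_atBot 0] with β hβ
    filter_upwards [hk.ae_mem] with x hx
    simp only [pow_zero, one_mul, Real.norm_eq_abs, Real.abs_exp]
    exact Real.exp_le_one_iff.2 (mul_nonpos_of_nonpos_of_nonneg hβ hx.1.le)
  · filter_upwards [hk.ae_mem] with x hx
    simp only [pow_zero, one_mul]
    exact Real.tendsto_exp_atBot.comp (tendsto_id.atBot_mul_const hx.1)

theorem existsUnique_expMoment_zero_eq (hk : IsLevyKernel k M δ) {u : ℝ} (hu : 0 < u) :
    ∃! b, expMoment (kernelMeasure k) 0 b = u := by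
  have := hk.isFiniteMeasure
  have hcont : Continuous (expMoment (kernelMeasure k) 0) :=
    continuous_iff_continuousAt.2 fun β => (hasDerivAt_expMoment hk.ae_mem 0 β).continuousAt
  obtain ⟨b1, hb1⟩ := (hk.tendsto_expMoment_zero_atBot.eventually_lt_const hu).exists
  obtain ⟨b2, hb2⟩ := (hk.tendsto_expMoment_zero_atTop.eventually_ge_atTop u).exists
  obtain ⟨b, hb⟩ := mem_range_of_exists_le_of_exists_ge hcont ⟨b1, hb1.le⟩ ⟨b2, hb2⟩
  exact ⟨b, hb, fun c hc => hk.strictMono_expMoment_zero.injective (hc.trans hb.symm)⟩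

end IsLevyKernel

end LevyTail

/-! ### Plancherel for the tilted kernel on vertical lines. -/

namespace LevyTail

open MeasureTheory Filter Topology FourierTransform SchwartzMap
open scoped Convolution ENNReal ContDiff

open ProbabilityTheory

section Tilt

variable {k : ℝ → ℝ} {M δ : ℝ}

theorem IsLevyKernel.abs_tilt_le (hk : IsLevyKernel k M δ) (β x : ℝ) :
    |Real.exp (β * x) * k x| ≤ Real.exp |β| * M := by
  by_cases hx : x ∈ Set.Ioc (0 : ℝ) 1
  · rw [abs_mul, Real.abs_exp]
    exact mul_le_mul (exp_mul_le_exp_abs β hx) (hk.abs_le x) (abs_nonneg _) (Real.exp_pos _).le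
  · rw [hk.eq_zero x hx]
    simpa using mul_nonneg (Real.exp_pos |β|).le hk.bound_nonneg

theorem IsLevyKernel.measurable_tilt (hk : IsLevyKernel k M δ) (β : ℝ) :
    Measurable fun x => Real.exp (β * x) * k x := by
  have := hk.measurable
  fun_prop

theorem IsLevyKernel.integrable_tilt (hk : IsLevyKernel k M δ) (β : ℝ) :
    Integrable fun x => Real.exp (β * x) * k x := by
  simp_rw [mul_comm (Real.exp _)]
  refine hk.integrable_mul (by fun_prop) (B := Real.exp |β|) fun x hx => ?_
  rw [Real.abs_exp]
  exact exp_mul_le_exp_abs β hx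

theorem IsLevyKernel.memLp_tilt (hk : IsLevyKernel k M δ) (β : ℝ) :
    MemLp (fun x => ((Real.exp (β * x) * k x : ℝ) : ℂ)) 2 := by
  have hm : AEStronglyMeasurable (fun x => ((Real.exp (β * x) * k x : ℝ) : ℂ)) volume :=
    (Complex.measurable_ofReal.comp (hk.measurable_tilt β)).aestronglyMeasurable
  rw [memLp_two_iff_integrable_sq_norm hm]
  have := (hk.integrable_tilt β).bdd_mul (c := Real.exp |β| * M)
    (hk.measurable_tilt β).aestronglyMeasurable
    (Eventually.of_forall fun x => hk.abs_tilt_le β x)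
  refine this.congr (Eventually.of_forall fun x => ?_)
  simp only [Complex.norm_real, Real.norm_eq_abs, sq_abs]
  ring

theorem IsLevyKernel.fourier_tilt (hk : IsLevyKernel k M δ) (β s : ℝ) :
    𝓕 (fun x => ((Real.exp (β * x) * k x : ℝ) : ℂ)) s =
      complexMGF id (kernelMeasure k) (β + ((-(2 * Real.pi) * s : ℝ) : ℂ) * Complex.I) := by
  rw [complexMGF, hk.integral_eq, Real.fourier_eq']
  refine integral_congr_ae (Eventually.of_forall fun x => ?_)
  simp only [smul_eq_mul, RCLike.inner_apply, conj_trivial, id, Complex.real_smul]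
  rw [add_mul, Complex.exp_add]
  push_cast
  ring_nf

theorem IsLevyKernel.integrable_norm_sq_complexMGF (hk : IsLevyKernel k M δ) (β : ℝ) :
    Integrable fun t : ℝ => ‖complexMGF id (kernelMeasure k) (β + t * Complex.I)‖ ^ 2 := by
  have h := integrable_norm_sq_fourier (hk.integrable_tilt β).ofReal (hk.memLp_tilt β)
  have h2 : Integrable fun s : ℝ => ‖complexMGF id (kernelMeasure k)
      (β + ((-(2 * Real.pi) * s : ℝ) : ℂ) * Complex.I)‖ ^ 2 := by
    refine h.congr (Eventually.of_forall fun s => ?_)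
    simp only []
    rw [← hk.fourier_tilt]
    rfl
  exact (integrable_comp_mul_left_iff (fun t : ℝ =>
    ‖complexMGF id (kernelMeasure k) (β + t * Complex.I)‖ ^ 2)
    (by have := Real.pi_pos; simp [this.ne'])).1 h2

/-- The tilted kernel is at most `M e^β` on an interval of length 1. The factor `2π` comes from the
substitution `t = -2πs` between the two Fourier normalisations. -/
theorem IsLevyKernel.integral_norm_sq_complexMGF_le (hk : IsLevyKernel k M δ) {β : ℝ}
    (hβ : 0 ≤ β) :
    ∫ t : ℝ, ‖complexMGF id (kernelMeasure k) (β + t * Complex.I)‖ ^ 2 ≤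
      2 * Real.pi * M ^ 2 * Real.exp (2 * β) := by
  have h := integral_norm_sq_fourier (hk.integrable_tilt β).ofReal (hk.memLp_tilt β)
  have h1 : ∫ s, ‖𝓕 (fun x => ((Real.exp (β * x) * k x : ℝ) : ℂ)) s‖ ^ 2 =
      (2 * Real.pi)⁻¹ * ∫ t : ℝ, ‖complexMGF id (kernelMeasure k) (β + t * Complex.I)‖ ^ 2 := by
    simp_rw [hk.fourier_tilt]
    have := Measure.integral_comp_mul_left (fun t : ℝ =>
      ‖complexMGF id (kernelMeasure k) (β + t * Complex.I)‖ ^ 2) (-(2 * Real.pi))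
    rw [this, smul_eq_mul, abs_inv, abs_neg, abs_of_pos (by positivity)]
  have h2 : ∫ x, ‖((Real.exp (β * x) * k x : ℝ) : ℂ)‖ ^ 2 ≤ (Real.exp β * M) ^ 2 := by
    have h3 : ∫ x, ‖((Real.exp (β * x) * k x : ℝ) : ℂ)‖ ^ 2 ≤
        ∫ x, (Set.Ioc (0 : ℝ) 1).indicator (fun _ => (Real.exp β * M) ^ 2) x := by
      refine integral_mono ((memLp_two_iff_integrable_sq_norm
        (hk.memLp_tilt β).aestronglyMeasurable).1 (hk.memLp_tilt β))
        ((integrable_indicator_iff measurableSet_Ioc).2 (integrableOn_const (by simp)))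
        fun x => ?_
      by_cases hx : x ∈ Set.Ioc (0 : ℝ) 1
      · rw [Set.indicator_of_mem hx]
        have := hk.abs_tilt_le β x
        rw [abs_of_nonneg hβ] at this
        simp only [Complex.norm_real, Real.norm_eq_abs]
        gcongr
      · simp [hk.eq_zero x hx, Set.indicator_of_notMem hx]
    simpa [integral_indicator] using h3
  have h4 : (2 * Real.pi)⁻¹ * ∫ t : ℝ,
      ‖complexMGF id (kernelMeasure k) (β + t * Complex.I)‖ ^ 2 ≤ (Real.exp β * M) ^ 2 := by
    rw [← h1]; exact h.le.trans h2
  rw [inv_mul_le_iff₀ (by positivity)] at h4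
  refine h4.trans_eq ?_
  rw [two_mul β, Real.exp_add]
  ring

end Tilt

/-! ### The law determined by its moment generating function, and size-biasing. -/

section Law

variable {k : ℝ → ℝ} {M δ : ℝ} {μ : Measure ℝ}

/-- The law `μ` has the moment generating function of the infinitely divisible law with Lévy
measure `k(x) / x dx`. -/
def IsLevyLaw (μ : Measure ℝ) (k : ℝ → ℝ) : Prop :=
  ∀ θ : ℝ, mgf id μ θ = Real.exp (∫ x, (Real.exp (θ * x) - 1) / x ∂(kernelMeasure k))

theorem IsLevyLaw.integrable_exp (h : IsLevyLaw μ k) (θ : ℝ) :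
    Integrable (fun x => Real.exp (θ * x)) μ := by
  by_contra hc
  have := h θ
  rw [mgf_undef (X := id) hc] at this
  exact (Real.exp_pos _).ne this

theorem IsLevyLaw.integrableExpSet_eq (h : IsLevyLaw μ k) : integrableExpSet id μ = Set.univ :=
  Set.eq_univ_of_forall h.integrable_exp

theorem IsLevyLaw.differentiable_complexMGF (h : IsLevyLaw μ k) :
    Differentiable ℂ (complexMGF id μ) := fun z =>
  (ProbabilityTheory.hasDerivAt_complexMGF
    (by rw [h.integrableExpSet_eq]; simp)).differentiableAt

/-- Both sides are entire and agree on the real axis, so the identity theorem applies. -/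
theorem IsLevyLaw.complexMGF_eq [IsProbabilityMeasure μ] (h : IsLevyLaw μ k) (hk : IsLevyKernel k M δ) (z : ℂ) :
    complexMGF id μ z = Complex.exp (complexCumulant (kernelMeasure k) z) := by
  have := hk.isFiniteMeasure
  have hd : Differentiable ℂ fun z => Complex.exp (complexCumulant (kernelMeasure k) z) :=
    fun z => (hasDerivAt_complexCumulant hk.ae_mem z).differentiableAt.cexp
  have hreal : ∀ x : ℝ, complexMGF id μ x =
      Complex.exp (complexCumulant (kernelMeasure k) x) := fun x => by
    rw [complexMGF_ofReal, h x, complexCumulant_ofReal, Complex.ofReal_exp]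
  refine congrFun (AnalyticOnNhd.eq_of_frequently_eq (z₀ := 0)
    (h.differentiable_complexMGF.differentiableOn.analyticOnNhd isOpen_univ)
    (hd.differentiableOn.analyticOnNhd isOpen_univ) ?_) z
  rw [frequently_iff_seq_forall]
  have ht : Tendsto (fun n : ℕ => ((1 / ((n : ℝ) + 1) : ℝ) : ℂ)) atTop (𝓝[≠] 0) := by
    refine tendsto_nhdsWithin_iff.2 ⟨?_, Eventually.of_forall fun n => ?_⟩
    · rw [← Complex.ofReal_zero]
      exact (Complex.continuous_ofReal.tendsto 0).comp tendsto_one_div_add_atTop_nhds_zero_nat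
    · have : (1 / ((n : ℝ) + 1)) ≠ 0 := by positivity
      exact Complex.ofReal_ne_zero.2 this
  exact ⟨_, ht, fun n => hreal _⟩

/-- Chernoff's bound at `θ = -n`: the cumulant is nonpositive there, so the mass of `(-∞, -e]` is at
most `e^{-en}` for every `n`. -/
theorem IsLevyLaw.measure_Iio_zero [IsProbabilityMeasure μ] (h : IsLevyLaw μ k) (hk : IsLevyKernel k M δ) :
    μ (Set.Iio 0) = 0 := by
  have hle : ∀ n : ℕ, mgf id μ (-(n : ℝ)) ≤ 1 := fun n => by
    rw [h, Real.exp_le_one_iff]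
    refine integral_nonpos_of_ae (hk.ae_mem.mono fun x hx => ?_)
    refine div_nonpos_of_nonpos_of_nonneg (sub_nonpos.2 (Real.exp_le_one_iff.2 ?_)) hx.1.le
    have := hx.1
    have : (0 : ℝ) ≤ n := n.cast_nonneg
    nlinarith
  have hz : ∀ e : ℝ, 0 < e → μ.real {x | x ≤ -e} = 0 := by
    intro e he
    have hb : ∀ n : ℕ, μ.real {x | x ≤ -e} ≤ Real.exp (-e * n) := fun n => by
      have := measure_le_le_exp_mul_mgf (X := id) (μ := μ) (-e) (t := -(n : ℝ)) (by simp)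
        (h.integrable_exp _)
      refine this.trans ?_
      calc _ ≤ Real.exp (-(-(n : ℝ)) * -e) * 1 :=
            mul_le_mul_of_nonneg_left (hle n) (Real.exp_pos _).le
        _ = _ := by ring_nf
    have ht : Tendsto (fun n : ℕ => Real.exp (-e * n)) atTop (𝓝 0) :=
      Real.tendsto_exp_atBot.comp
        (tendsto_natCast_atTop_atTop.const_mul_atTop_of_neg (by linarith))
    exact le_antisymm (ge_of_tendsto' ht hb) measureReal_nonneg
  have hu : Set.Iio (0 : ℝ) ⊆ ⋃ n : ℕ, {x | x ≤ -(1 / ((n : ℝ) + 1))} := by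
    intro x hx
    obtain ⟨n, hn⟩ := exists_nat_one_div_lt (show (0 : ℝ) < -x by simpa using hx)
    exact Set.mem_iUnion.2 ⟨n, by change x ≤ _; linarith⟩
  refine measure_mono_null hu (measure_iUnion_null fun n => ?_)
  have := hz (1 / ((n : ℝ) + 1)) (by positivity)
  exact (measureReal_eq_zero_iff).1 this

theorem IsLevyLaw.ae_nonneg [IsProbabilityMeasure μ] (h : IsLevyLaw μ k) (hk : IsLevyKernel k M δ) :
    ∀ᵐ x ∂μ, 0 ≤ x := by
  rw [ae_iff]
  simpa [Set.Iio] using! h.measure_Iio_zero hk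

theorem conv_kernelMeasure_eq [IsProbabilityMeasure μ] (hk : Measurable k) :
    kernelMeasure k ∗ μ =
      volume.withDensity fun x => ∫⁻ y, ENNReal.ofReal (k (x - y)) ∂μ := by
  have hm : Measurable fun p : ℝ × ℝ => ENNReal.ofReal (k (p.1 - p.2)) := by fun_prop
  have : SFinite (kernelMeasure k) := by unfold kernelMeasure; infer_instance
  refine Measure.ext_of_lintegral _ fun f hf => ?_
  rw [Measure.conv_comm, Measure.lintegral_conv hf,
    lintegral_withDensity_eq_lintegral_mul _ hm.lintegral_prod_right' hf]
  simp only [Pi.mul_apply]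
  calc ∫⁻ y, ∫⁻ x, f (y + x) ∂(kernelMeasure k) ∂μ
      = ∫⁻ y, (∫⁻ x, ENNReal.ofReal (k (x - y)) * f x) ∂μ := by
        refine lintegral_congr fun y => ?_
        rw [kernelMeasure, lintegral_withDensity_eq_lintegral_mul _ hk.ennreal_ofReal
          (by fun_prop)]
        rw [← lintegral_add_left_eq_self (μ := volume)
          (fun x => ENNReal.ofReal (k (x - y)) * f x) y]
        simp
    _ = ∫⁻ x, ∫⁻ y, ENNReal.ofReal (k (x - y)) * f x ∂μ := by
        refine lintegral_lintegral_swap ?_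
        exact ((hm.comp measurable_swap).mul (hf.comp measurable_snd)).aemeasurable
    _ = _ := by
        refine lintegral_congr fun x => ?_
        rw [lintegral_mul_const]
        exact hm.comp (measurable_const.prodMk measurable_id)

/-- The size-bias identity `x μ(dx) = (k dx) ∗ μ`. -/
theorem IsLevyLaw.withDensity_id_eq [IsProbabilityMeasure μ] (h : IsLevyLaw μ k) (hk : IsLevyKernel k M δ) :
    μ.withDensity ENNReal.ofReal = kernelMeasure k ∗ μ := by
  have := hk.isFiniteMeasure
  have hint : ∀ z : ℂ, HasDerivAt (complexMGF id μ) (∫ x, (x : ℂ) * Complex.exp (z * x) ∂μ) z :=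
    fun z => hasDerivAt_complexMGF (by rw [h.integrableExpSet_eq]; simp)
  have hid : Integrable (fun x : ℝ => x) μ := by
    have := integrable_pow_of_mem_interior_integrableExpSet (X := id) (μ := μ)
      (by rw [h.integrableExpSet_eq]; simp) 1
    simpa using this
  have hfin : IsFiniteMeasure (μ.withDensity ENNReal.ofReal) :=
    isFiniteMeasure_withDensity_ofReal hid.2
  -- The transform of `x μ(dx)` is the derivative of `e^C`, that is `C' e^C`, and `C'` is the
  -- transform of `k dx`.
  refine Measure.ext_of_charFun (funext fun t => ?_)
  rw [charFun_conv, ← complexMGF_id_mul_I, ← complexMGF_id_mul_I, ← complexMGF_id_mul_I,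
    complexMGF, integral_withDensity_eq_integral_toReal_smul ENNReal.measurable_ofReal
      (Eventually.of_forall fun x => ENNReal.ofReal_lt_top)]
  have h1 := (hint (t * Complex.I)).unique (by
    have h2 := (hasDerivAt_complexCumulant hk.ae_mem (t * Complex.I)).cexp
    have h3 : complexMGF id μ = fun z => Complex.exp (complexCumulant (kernelMeasure k) z) :=
      funext fun z => h.complexMGF_eq hk z
    rw [h3]
    exact h2)
  rw [← h.complexMGF_eq hk] at h1
  rw [mul_comm (complexMGF id (kernelMeasure k) _), ← h1]
  refine integral_congr_ae ((h.ae_nonneg hk).mono fun x hx => ?_)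
  simp [ENNReal.toReal_ofReal hx]

end Law

end LevyTail

/-! ### The density, its convolution equation, and inversion after two convolutions. -/

namespace LevyTail

open MeasureTheory Filter Topology FourierTransform SchwartzMap
open scoped Convolution ENNReal ContDiff

open ProbabilityTheory

section Density

variable {k : ℝ → ℝ} {M δ : ℝ} {μ : Measure ℝ}

/-- The density `x ↦ ∫ k(x - y) dμ(y)` of the convolution `(k dx) ∗ μ`. -/
noncomputable def convDensity (k : ℝ → ℝ) (μ : Measure ℝ) (x : ℝ) : ℝ := ∫ y, k (x - y) ∂μ

theorem IsLevyKernel.measurable_sub (hk : IsLevyKernel k M δ) (x : ℝ) :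
    Measurable fun y => k (x - y) :=
  hk.measurable.comp (measurable_const.sub measurable_id)

theorem IsLevyKernel.integrable_sub [IsProbabilityMeasure μ] (hk : IsLevyKernel k M δ) (x : ℝ) :
    Integrable (fun y => k (x - y)) μ :=
  Integrable.of_bound (hk.measurable_sub x).aestronglyMeasurable M
    (Eventually.of_forall fun _ => hk.abs_le _)

theorem IsLevyKernel.convDensity_nonneg (hk : IsLevyKernel k M δ) (x : ℝ) :
    0 ≤ convDensity k μ x :=
  integral_nonneg fun _ => hk.nonneg _

theorem IsLevyKernel.convDensity_le [IsProbabilityMeasure μ] (hk : IsLevyKernel k M δ) (x : ℝ) :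
    convDensity k μ x ≤ M := by
  have := integral_mono (μ := μ) (hk.integrable_sub x) (integrable_const M) fun y => hk.le (x - y)
  simpa [convDensity] using this

theorem IsLevyKernel.measurable_convDensity [IsProbabilityMeasure μ] (hk : IsLevyKernel k M δ) :
    Measurable (convDensity k μ) := by
  have hm : Measurable fun p : ℝ × ℝ => k (p.1 - p.2) :=
    hk.measurable.comp (measurable_fst.sub measurable_snd)
  exact (hm.stronglyMeasurable.integral_prod_right' (ν := μ)).measurable

theorem IsLevyKernel.ofReal_convDensity [IsProbabilityMeasure μ] (hk : IsLevyKernel k M δ) (x : ℝ) :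
    ENNReal.ofReal (convDensity k μ x) = ∫⁻ y, ENNReal.ofReal (k (x - y)) ∂μ :=
  ofReal_integral_eq_lintegral_ofReal (hk.integrable_sub x) (Eventually.of_forall fun _ =>
    hk.nonneg _)

theorem IsLevyLaw.withDensity_id_eq_convDensity [IsProbabilityMeasure μ] (h : IsLevyLaw μ k) (hk : IsLevyKernel k M δ) :
    μ.withDensity ENNReal.ofReal =
      volume.withDensity fun x => ENNReal.ofReal (convDensity k μ x) := by
  rw [h.withDensity_id_eq hk, conv_kernelMeasure_eq hk.measurable]
  simp_rw [hk.ofReal_convDensity]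

/-- Divide the size-bias identity by `x` on `(0, ∞)`. There is no mass below 0, so only a possible
atom at 0 is left. -/
theorem IsLevyLaw.exists_isDefectiveDensity [IsProbabilityMeasure μ] (h : IsLevyLaw μ k) (hk : IsLevyKernel k M δ) :
    IsDefectiveDensity μ ((Set.Ioi 0).indicator fun x => convDensity k μ x / x) := by
  have hm := hk.measurable_convDensity (μ := μ)
  have hmf : Measurable ((Set.Ioi (0 : ℝ)).indicator fun x => convDensity k μ x / x) :=
    (hm.div measurable_id).indicator measurableSet_Ioi
  refine ⟨hmf, fun x => ?_, ?_⟩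
  · exact Set.indicator_nonneg (fun x hx => div_nonneg (hk.convDensity_nonneg x) (le_of_lt hx)) x
  have hpos : ∀ s : Set ℝ, MeasurableSet s → μ (s ∩ Set.Ioi 0) =
      ∫⁻ x in s, ENNReal.ofReal ((Set.Ioi 0).indicator (fun x => convDensity k μ x / x) x) := by
    intro s hs
    have hs' := hs.inter (measurableSet_Ioi (a := (0 : ℝ)))
    have hi : Measurable fun x : ℝ => ENNReal.ofReal x⁻¹ := by fun_prop
    have h1 : ∫⁻ x in s ∩ Set.Ioi 0, ENNReal.ofReal x⁻¹ ∂(μ.withDensity ENNReal.ofReal) =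
        μ (s ∩ Set.Ioi 0) := by
      rw [setLIntegral_withDensity_eq_setLIntegral_mul _ ENNReal.measurable_ofReal hi hs']
      rw [← setLIntegral_one]
      refine setLIntegral_congr_fun hs' fun x hx => ?_
      have hx0 : (0 : ℝ) < x := hx.2
      simp only [Pi.mul_apply]
      rw [← ENNReal.ofReal_mul hx0.le, mul_inv_cancel₀ hx0.ne', ENNReal.ofReal_one]
    rw [← h1, h.withDensity_id_eq_convDensity hk,
      setLIntegral_withDensity_eq_setLIntegral_mul _ hm.ennreal_ofReal hi hs',
      Set.inter_comm, ← setLIntegral_indicator measurableSet_Ioi]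
    refine lintegral_congr fun x => ?_
    by_cases hx : x ∈ Set.Ioi (0 : ℝ)
    · rw [Set.indicator_of_mem hx, Set.indicator_of_mem hx, Pi.mul_apply,
        ← ENNReal.ofReal_mul (hk.convDensity_nonneg x), div_eq_mul_inv]
    · rw [Set.indicator_of_notMem hx, Set.indicator_of_notMem hx, ENNReal.ofReal_zero]
  refine Measure.ext fun s hs => ?_
  rw [Measure.add_apply, Measure.smul_apply, withDensity_apply _ hs, ← hpos s hs, smul_eq_mul]
  have h2 : μ s = μ (s ∩ Set.Ioi 0) + μ (s ∩ {0}) := by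
    rw [← measure_inter_add_sdiff s measurableSet_Ioi]
    congr 1
    refine le_antisymm ?_ (measure_mono fun x hx => ⟨hx.1, by simp [Set.mem_singleton_iff.1 hx.2]⟩)
    have hsub : s \ Set.Ioi 0 ⊆ (s ∩ {0}) ∪ Set.Iio 0 := by
      rintro x ⟨hx, hx'⟩
      rcases lt_trichotomy x 0 with h0 | h0 | h0
      · exact Or.inr h0
      · exact Or.inl ⟨hx, h0⟩
      · exact absurd h0 hx'
    refine (measure_mono hsub).trans ((measure_union_le _ _).trans ?_)
    rw [h.measure_Iio_zero hk, add_zero]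
  rw [h2, add_comm]
  congr 1
  by_cases h0 : (0 : ℝ) ∈ s
  · rw [Set.inter_eq_right.2 (by simpa using h0), Measure.dirac_apply_of_mem h0, mul_one]
  · rw [Measure.dirac_apply' _ hs, Set.indicator_of_notMem h0, mul_zero,
      Set.inter_singleton_eq_empty.2 h0, measure_empty]

variable {f : ℝ → ℝ}

theorem IsDefectiveDensity.isFiniteMeasure [IsProbabilityMeasure μ] (hf : IsDefectiveDensity μ f) :
    IsFiniteMeasure (volume.withDensity fun x => ENNReal.ofReal (f x)) := by
  refine isFiniteMeasure_of_le μ ?_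
  conv_rhs => rw [hf.2.2]
  exact Measure.le_add_left le_rfl

theorem IsDefectiveDensity.integrable [IsProbabilityMeasure μ] (hf : IsDefectiveDensity μ f) : Integrable f := by
  have := hf.isFiniteMeasure
  refine ⟨hf.1.aestronglyMeasurable, ?_⟩
  rw [hasFiniteIntegral_iff_ofReal (Eventually.of_forall hf.2.1), ← setLIntegral_univ,
    ← withDensity_apply _ MeasurableSet.univ]
  exact measure_lt_top _ _

/-- Weighting by `x` kills the atom at 0, and densities are unique almost everywhere. -/
theorem IsDefectiveDensity.ae_mul_eq [IsProbabilityMeasure μ] (hf : IsDefectiveDensity μ f) (h : IsLevyLaw μ k)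
    (hk : IsLevyKernel k M δ) : ∀ᵐ x : ℝ, 0 < x → x * f x = convDensity k μ x := by
  have hm := hk.measurable_convDensity (μ := μ)
  have h1 := h.withDensity_id_eq_convDensity hk
  have h2 : μ.withDensity ENNReal.ofReal =
      volume.withDensity ((fun x => ENNReal.ofReal (f x)) * ENNReal.ofReal) := by
    rw [withDensity_mul _ hf.1.ennreal_ofReal ENNReal.measurable_ofReal]
    conv_lhs => rw [hf.2.2]
    rw [withDensity_add_measure, withDensity_smul_measure,
      withDensity_congr_ae (g := 0) (by rw [EventuallyEq, ae_dirac_eq]; simp), withDensity_zero,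
      smul_zero, zero_add]
  rw [h2] at h1
  have h3 := (withDensity_eq_iff_of_sigmaFinite
    (hf.1.ennreal_ofReal.mul ENNReal.measurable_ofReal).aemeasurable
    hm.ennreal_ofReal.aemeasurable).1 h1
  filter_upwards [h3] with x hx h0
  rw [Pi.mul_apply, ← ENNReal.ofReal_mul (hf.2.1 x), ENNReal.ofReal_eq_ofReal_iff
    (mul_nonneg (hf.2.1 x) h0.le) (hk.convDensity_nonneg x)] at hx
  rw [mul_comm, hx]

/-- The atom at 0 would contribute a multiple of `k(x)`, which vanishes for `x > 1`. What remains is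
a bounded function convolved with an integrable one, hence continuous. -/
theorem IsDefectiveDensity.convDensity_eq [IsProbabilityMeasure μ] (hf : IsDefectiveDensity μ f)
    (hk : IsLevyKernel k M δ) {x : ℝ} (hx : 1 < x) :
    convDensity k μ x = ∫ y, k (x - y) * f y := by
  have := hf.isFiniteMeasure
  have hfi : IsFiniteMeasure (μ {0} • Measure.dirac (0 : ℝ)) := by
    refine isFiniteMeasure_of_le μ ?_
    conv_rhs => rw [hf.2.2]
    exact Measure.le_add_right le_rfl
  have hb : ∀ ρ : Measure ℝ, IsFiniteMeasure ρ → Integrable (fun y => k (x - y)) ρ := fun ρ _ =>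
    Integrable.of_bound (hk.measurable_sub x).aestronglyMeasurable M
      (Eventually.of_forall fun _ => hk.abs_le _)
  rw [convDensity]
  conv_lhs => rw [hf.2.2]
  rw [integral_add_measure (hb _ hfi) (hb _ this), integral_smul_measure, integral_dirac,
    sub_zero, hk.eq_zero x (fun h => by linarith [h.2]), smul_zero, zero_add,
    integral_withDensity_eq_integral_toReal_smul hf.1.ennreal_ofReal
      (Eventually.of_forall fun x => ENNReal.ofReal_lt_top)]
  refine integral_congr_ae (Eventually.of_forall fun y => ?_)
  simp only [smul_eq_mul, ENNReal.toReal_ofReal (hf.2.1 y), mul_comm]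

theorem IsDefectiveDensity.continuousOn_convDensity [IsProbabilityMeasure μ] (hf : IsDefectiveDensity μ f)
    (hk : IsLevyKernel k M δ) : ContinuousOn (convDensity k μ) (Set.Ioi 1) :=
  (continuous_integral_sub_mul_of_bounded hk.measurable hk.abs_le hf.integrable).continuousOn.congr
    fun _ hx => hf.convDensity_eq hk hx

theorem IsDefectiveDensity.mul_eq [IsProbabilityMeasure μ] (hf : IsDefectiveDensity μ f) (h : IsLevyLaw μ k)
    (hk : IsLevyKernel k M δ) (hc : ContinuousOn f (Set.Ioi 1)) {x : ℝ} (hx : 1 < x) :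
    x * f x = convDensity k μ x := by
  refine Measure.eqOn_open_of_ae_eq (μ := volume) (U := Set.Ioi 1) (f := fun x => x * f x) ?_
    isOpen_Ioi (continuousOn_id.mul hc) (hf.continuousOn_convDensity hk) hx
  rw [EventuallyEq, ae_restrict_iff' measurableSet_Ioi]
  filter_upwards [hf.ae_mul_eq h hk] with y hy h1
  exact hy (zero_lt_one.trans h1)

/-- The density `∫ k(x - y) ∫ k(y - z) dμ(z) dy` of `(k dx) ∗ (k dx) ∗ μ`. -/
noncomputable def convDensityTwo (k : ℝ → ℝ) (μ : Measure ℝ) (x : ℝ) : ℝ :=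
  ∫ y, k (x - y) * convDensity k μ y

theorem IsLevyKernel.integrable_comp_sub (hk : IsLevyKernel k M δ) (x : ℝ) :
    Integrable fun y => k (x - y) :=
  hk.integrable.comp_sub_left x

theorem IsLevyKernel.integrable_mul_convDensity [IsProbabilityMeasure μ] (hk : IsLevyKernel k M δ) (x : ℝ) :
    Integrable fun y => k (x - y) * convDensity k μ y := by
  refine (hk.integrable_comp_sub x).mul_bdd (c := M)
    hk.measurable_convDensity.aestronglyMeasurable (Eventually.of_forall fun y => ?_)
  rw [Real.norm_eq_abs, abs_of_nonneg (hk.convDensity_nonneg y)]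
  exact hk.convDensity_le y

theorem IsLevyKernel.convDensityTwo_nonneg (hk : IsLevyKernel k M δ) (x : ℝ) :
    0 ≤ convDensityTwo k μ x :=
  integral_nonneg fun y => mul_nonneg (hk.nonneg _) (hk.convDensity_nonneg y)

/-- The factor `k(x - y)` forces `x - 1 ≤ y < x`, so the weight in `convDensity k μ y = y f(y)` can
be replaced by `x` or `x - 1`. Taking `x > 2` keeps `y > 1`, where that identity holds pointwise. -/
theorem IsDefectiveDensity.mul_bounds [IsProbabilityMeasure μ] (hf : IsDefectiveDensity μ f) (h : IsLevyLaw μ k)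
    (hk : IsLevyKernel k M δ) (hc : ContinuousOn f (Set.Ioi 1)) {x : ℝ} (hx : 2 < x) :
    convDensityTwo k μ x ≤ x * (x * f x) ∧ (x - 1) * (x * f x) ≤ convDensityTwo k μ x := by
  have hi : Integrable fun y => k (x - y) * f y :=
    hf.integrable.bdd_mul (c := M) (hk.measurable_sub x).aestronglyMeasurable
      (Eventually.of_forall fun _ => hk.abs_le _)
  have hi2 := hk.integrable_mul_convDensity (μ := μ) x
  have hpt : ∀ y, k (x - y) * convDensity k μ y ≤ x * (k (x - y) * f y) ∧
      (x - 1) * (k (x - y) * f y) ≤ k (x - y) * convDensity k μ y := by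
    intro y
    by_cases hy : x - y ∈ Set.Ioc (0 : ℝ) 1
    · rw [← hf.mul_eq h hk hc (x := y) (by linarith [hy.2])]
      have hp : 0 ≤ k (x - y) * f y := mul_nonneg (hk.nonneg _) (hf.2.1 y)
      constructor <;> nlinarith [hy.1, hy.2]
    · simp [hk.eq_zero _ hy]
  rw [hf.mul_eq h hk hc (by linarith), hf.convDensity_eq hk (by linarith), ← integral_const_mul,
    ← integral_const_mul]
  exact ⟨integral_mono hi2 (hi.const_mul x) fun y => (hpt y).1,
    integral_mono (hi.const_mul _) hi2 fun y => (hpt y).2⟩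

theorem IsLevyKernel.convDensityTwo_eq [IsProbabilityMeasure μ] (hk : IsLevyKernel k M δ) (x : ℝ) :
    convDensityTwo k μ x = ∫ z, (∫ y, k (x - z - y) * k y) ∂μ := by
  have e1 : convDensityTwo k μ x = ∫ y, (∫ z, k (x - y) * k (y - z) ∂μ) := by
    simp only [convDensityTwo, convDensity, integral_const_mul]
  have hint : Integrable (Function.uncurry fun y z => k (x - y) * k (y - z))
      (volume.prod μ) := by
    refine ((hk.integrable_comp_sub x).comp_fst μ).mul_bdd (c := M) ?_
      (Eventually.of_forall fun p => hk.abs_le _)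
    exact (hk.measurable.comp (measurable_fst.sub measurable_snd)).aestronglyMeasurable
  rw [e1, integral_integral_swap hint]
  refine integral_congr_ae (Eventually.of_forall fun z => ?_)
  simp only []
  rw [← integral_add_right_eq_self (μ := volume) (fun y => k (x - y) * k (y - z)) z]
  refine integral_congr_ae (Eventually.of_forall fun y => ?_)
  simp only [add_sub_cancel_right]
  rw [show x - (y + z) = x - z - y by ring]

/-- Fourier inversion for `(k dx) ∗ (k dx) ∗ μ`, exponentially tilted. -/
theorem IsLevyLaw.exp_mul_convDensityTwo_eq [IsProbabilityMeasure μ] (h : IsLevyLaw μ k) (hk : IsLevyKernel k M δ)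
    (β x : ℝ) :
    ((Real.exp (β * x) * convDensityTwo k μ x : ℝ) : ℂ) = (2 * Real.pi)⁻¹ * ∫ t : ℝ,
      complexMGF id (kernelMeasure k) (β + t * Complex.I) ^ 2 *
        Complex.exp (complexCumulant (kernelMeasure k) (β + t * Complex.I) -
          t * x * Complex.I) := by
  set Q : ℝ → ℂ := 𝓕 (fun x => ((Real.exp (β * x) * k x : ℝ) : ℂ)) with hQ
  have hQi : Integrable fun s => Q s ^ 2 := by
    rw [← integrable_norm_iff (by
      exact ((continuous_fourier_of_integrable
        (hk.integrable_tilt β).ofReal).pow 2).aestronglyMeasurable)]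
    simp only [norm_pow]
    exact integrable_norm_sq_fourier (hk.integrable_tilt β).ofReal (hk.memLp_tilt β)
  -- The tilt is multiplicative over `x = z + (x - z - y) + y`, so it passes onto `μ` and both
  -- copies of `k`.
  have hE : ∀ z : ℝ, Real.exp (β * x) * ∫ y, k (x - z - y) * k y =
      Real.exp (β * z) * ∫ y, (Real.exp (β * (x - z - y)) * k (x - z - y)) *
        (Real.exp (β * y) * k y) := by
    intro z
    rw [← integral_const_mul, ← integral_const_mul]
    refine integral_congr_ae (Eventually.of_forall fun y => ?_)
    simp only []
    have : Real.exp (β * x) = Real.exp (β * z) * Real.exp (β * (x - z - y)) *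
        Real.exp (β * y) := by
      rw [← Real.exp_add, ← Real.exp_add]; ring_nf
    rw [this]; ring
  have e1 : ((Real.exp (β * x) * convDensityTwo k μ x : ℝ) : ℂ) =
      ∫ z, (∫ s : ℝ, (Real.exp (β * z) : ℂ) *
        (Q s ^ 2 * Complex.exp (2 * Real.pi * s * (x - z) * Complex.I))) ∂μ := by
    rw [hk.convDensityTwo_eq, ← integral_const_mul, ← integral_complex_ofReal]
    refine integral_congr_ae (Eventually.of_forall fun z => ?_)
    simp only []
    rw [hE, Complex.ofReal_mul, integral_sub_mul_self_eq_fourier (hk.measurable_tilt β)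
      (hk.abs_tilt_le β) (hk.integrable_tilt β) (hk.memLp_tilt β), integral_const_mul]
    simp only [Complex.ofReal_sub]
    rfl
  have hint : Integrable (Function.uncurry fun (z s : ℝ) => (Real.exp (β * z) : ℂ) *
        (Q s ^ 2 * Complex.exp (2 * Real.pi * s * (x - z) * Complex.I))) (μ.prod volume) := by
    have h1 : Integrable (fun p : ℝ × ℝ => (Real.exp (β * p.1) : ℂ) * Q p.2 ^ 2)
        (μ.prod volume) := (h.integrable_exp β).ofReal.mul_prod hQi
    have h2 := h1.mul_bdd (c := 1)
      (g := fun p : ℝ × ℝ => Complex.exp (2 * Real.pi * p.2 * (x - p.1) * Complex.I))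
      (by fun_prop) (Eventually.of_forall fun p => by
        have := Complex.norm_exp_ofReal_mul_I (2 * Real.pi * p.2 * (x - p.1))
        push_cast at this
        exact this.le)
    refine h2.congr (Eventually.of_forall fun p => ?_)
    simp only [Function.uncurry, mul_assoc]
  rw [e1, integral_integral_swap hint]
  set F : ℝ → ℂ := fun t => complexMGF id (kernelMeasure k) (β + t * Complex.I) ^ 2 *
    Complex.exp (complexCumulant (kernelMeasure k) (β + t * Complex.I) - t * x * Complex.I)
    with hF
  have e2 : ∀ s : ℝ, ∫ z, (Real.exp (β * z) : ℂ) *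
        (Q s ^ 2 * Complex.exp (2 * Real.pi * s * (x - z) * Complex.I)) ∂μ =
      F (-(2 * Real.pi) * s) := by
    intro s
    have e3 : ∀ z : ℝ, (Real.exp (β * z) : ℂ) *
        (Q s ^ 2 * Complex.exp (2 * Real.pi * s * (x - z) * Complex.I)) =
        Q s ^ 2 * Complex.exp (-(((-(2 * Real.pi) * s : ℝ) : ℂ) * x * Complex.I)) *
        Complex.exp ((β + ((-(2 * Real.pi) * s : ℝ) : ℂ) * Complex.I) * z) := by
      intro z
      have : (Real.exp (β * z) : ℂ) * Complex.exp (2 * Real.pi * s * (x - z) * Complex.I) =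
          Complex.exp (-(((-(2 * Real.pi) * s : ℝ) : ℂ) * x * Complex.I)) *
          Complex.exp ((β + ((-(2 * Real.pi) * s : ℝ) : ℂ) * Complex.I) * z) := by
        rw [Complex.ofReal_exp, ← Complex.exp_add, ← Complex.exp_add]
        push_cast
        ring_nf
      rw [mul_left_comm, this]
      ring
    have e4 : ∫ z : ℝ, Complex.exp ((β + ((-(2 * Real.pi) * s : ℝ) : ℂ) * Complex.I) * z) ∂μ =
        complexMGF id μ (β + ((-(2 * Real.pi) * s : ℝ) : ℂ) * Complex.I) := rfl
    simp_rw [e3]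
    rw [integral_const_mul, e4, h.complexMGF_eq hk, hF, hQ, hk.fourier_tilt]
    beta_reduce
    rw [sub_eq_add_neg,
      Complex.exp_add]
    ring
  calc ∫ s, (∫ z, (Real.exp (β * z) : ℂ) *
        (Q s ^ 2 * Complex.exp (2 * Real.pi * s * (x - z) * Complex.I)) ∂μ)
      = ∫ s, F (-(2 * Real.pi) * s) := integral_congr_ae (Eventually.of_forall e2)
    _ = _ := by
      rw [Measure.integral_comp_mul_left, Complex.real_smul, abs_inv, abs_neg,
        abs_of_pos (by positivity)]

end Density

end LevyTail

/-! ### Laplace's method for the inversion integral. -/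

namespace LevyTail

open MeasureTheory Filter Topology FourierTransform SchwartzMap
open scoped Convolution ENNReal ContDiff

open ProbabilityTheory

theorem integrable_abs_pow_mul_gaussian {b : ℝ} (hb : 0 < b) (n : ℕ) :
    Integrable fun t : ℝ => Real.exp (-(b * t ^ 2)) * |t| ^ n := by
  have h := (integrable_rpow_mul_exp_neg_mul_sq hb (s := n)
    (by have : (0 : ℝ) ≤ n := n.cast_nonneg
        linarith)).norm
  refine h.congr (Eventually.of_forall fun t => ?_)
  simp [mul_comm]

theorem integral_abs_pow_mul_gaussian {u : ℝ} (hu : 0 < u) (c : ℝ) (n : ℕ) :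
    ∫ t : ℝ, Real.exp (-(c * u * t ^ 2)) * |t| ^ n =
      (∫ t : ℝ, Real.exp (-(c * t ^ 2)) * |t| ^ n) / Real.sqrt u ^ (n + 1) := by
  have hs := Real.sqrt_pos.2 hu
  have h := Measure.integral_comp_mul_left
    (fun t : ℝ => Real.exp (-(c * t ^ 2)) * |t| ^ n) (Real.sqrt u)
  have e : ∀ t : ℝ, Real.exp (-(c * (Real.sqrt u * t) ^ 2)) * |Real.sqrt u * t| ^ n =
      Real.sqrt u ^ n * (Real.exp (-(c * u * t ^ 2)) * |t| ^ n) := fun t => by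
    rw [abs_mul, abs_of_pos hs, mul_pow, mul_pow, Real.sq_sqrt hu.le, mul_assoc]
    ring
  simp_rw [e] at h
  rw [integral_const_mul, abs_of_pos (inv_pos.2 hs), smul_eq_mul, inv_mul_eq_div,
    eq_div_iff hs.ne'] at h
  rw [eq_div_iff (by positivity), ← h]
  ring

/-- A double exponential beats a single one. -/
theorem tendsto_exp_neg_exp_mul_exp {κ δ : ℝ} (hκ : 0 < κ) (hδ : δ ≤ 1 / 4) (B : ℝ) (hB : 0 ≤ B) :
    Tendsto (fun β : ℝ => Real.exp (-(κ * Real.exp (β * (1 - δ)))) * (B * Real.exp (2 * β)))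
      atTop (𝓝 0) := by
  -- With `w = κ e^{β/2}` one has `e^{2β} = (w/κ)⁴`, which reduces the claim to `w⁴ e^{-w} → 0`.
  have h1 : Tendsto (fun β : ℝ => κ * Real.exp (β / 2)) atTop atTop :=
    (Real.tendsto_exp_atTop.comp (tendsto_id.atTop_div_const two_pos)).const_mul_atTop hκ
  have h2 := ((Real.tendsto_pow_mul_exp_neg_atTop_nhds_zero 4).comp h1).const_mul (B / κ ^ 4)
  rw [mul_zero] at h2
  refine squeeze_zero' (Eventually.of_forall fun β => by positivity) ?_ h2
  filter_upwards [eventually_ge_atTop 0] with β hβ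
  have h3 : Real.exp (-(κ * Real.exp (β * (1 - δ)))) ≤ Real.exp (-(κ * Real.exp (β / 2))) := by
    refine Real.exp_le_exp.2 (neg_le_neg (mul_le_mul_of_nonneg_left (Real.exp_le_exp.2 ?_) hκ.le))
    nlinarith
  have h4 : Real.exp (2 * β) = Real.exp (β / 2) ^ 4 := by
    rw [← Real.exp_nat_mul]; push_cast; ring_nf
  calc _ ≤ Real.exp (-(κ * Real.exp (β / 2))) * (B * Real.exp (2 * β)) :=
        mul_le_mul_of_nonneg_right h3 (by positivity)
    _ = _ := by
        rw [h4]
        simp only [Function.comp_apply]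
        field_simp

section Estimate

variable {k : ℝ → ℝ} {M δ : ℝ}

theorem norm_cexp_sub_one_le (z : ℂ) : ‖Complex.exp z - 1‖ ≤ ‖z‖ * Real.exp ‖z‖ := by
  simpa using Complex.norm_exp_sub_sum_le_norm_mul_exp z 1

/-- The integrand of the inversion formula, normalised at `t = 0`. -/
noncomputable def inversionIntegrand (ν : Measure ℝ) (β x t : ℝ) : ℂ :=
  complexMGF id ν (β + t * Complex.I) ^ 2 *
    Complex.exp (complexCumulant ν (β + t * Complex.I) - complexCumulant ν β - t * x * Complex.I)

/-- At `x = u + y` with `u = C'(β)` the linear term of the Taylor expansion cancels up to the phase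
`e^{-ity}`. Three errors remain: `K² - u²` of size `u²|t|`, the cubic remainder of size `u|t|³`, and
the phase of size `|t|y`. -/
theorem norm_inversionIntegrand_sub_le_of_abs_le {ν : Measure ℝ} [IsFiniteMeasure ν]
    (hν : ∀ᵐ x ∂ν, x ∈ Set.Ioc (0 : ℝ) 1) {β y t : ℝ} (hy : 0 ≤ y)
    (hv : expMoment ν 0 β / 4 ≤ expMoment ν 1 β) (ht : |t| ≤ 1 / 4) :
    ‖inversionIntegrand ν β (expMoment ν 0 β + y) t -
        ((expMoment ν 0 β ^ 2 * Real.exp (-(expMoment ν 1 β / 2 * t ^ 2)) : ℝ) : ℂ)‖ ≤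
      expMoment ν 0 β ^ 2 * (Real.exp (-(1 / 16 * expMoment ν 0 β * t ^ 2)) *
        ((2 + y) * |t| + expMoment ν 0 β * |t| ^ 3)) := by
  have hK1 := norm_complexMGF_sub_expMoment_le hν β t
  have hK2 := norm_complexMGF_le_expMoment (ν := ν) β t
  have hT := norm_complexCumulant_taylor_le hν β (t := t) (by linarith)
  have hvu := expMoment_succ_le hν 0 β
  have hu0 := expMoment_nonneg hν 0 β
  rw [zero_add] at hvu
  unfold inversionIntegrand
  set u := expMoment ν 0 β
  set v := expMoment ν 1 β
  set K := complexMGF id ν (β + t * Complex.I)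
  set R : ℂ := complexCumulant ν (β + t * Complex.I) - complexCumulant ν β
      - (t * u * Complex.I - t ^ 2 / 2 * v) with hR
  set a : ℝ := -(v / 2 * t ^ 2) with ha
  set E : ℝ := Real.exp (-(1 / 16 * u * t ^ 2)) with hE
  have htt : |t| ^ 2 = t ^ 2 := sq_abs t
  have ht0 := abs_nonneg t
  have hw : complexCumulant ν (β + t * Complex.I) - complexCumulant ν β
      - t * ((u + y : ℝ) : ℂ) * Complex.I = a + R + Complex.I * ((-(t * y) : ℝ) : ℂ) := by
    rw [hR, ha]; push_cast; ring
  rw [hw, Complex.exp_add, Complex.exp_add, ← Complex.ofReal_exp]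
  have hphase : ‖Complex.exp (Complex.I * ((-(t * y) : ℝ) : ℂ))‖ = 1 := by
    rw [mul_comm]; exact Complex.norm_exp_ofReal_mul_I _
  have hphase1 : ‖Complex.exp (Complex.I * ((-(t * y) : ℝ) : ℂ)) - 1‖ ≤ |t| * y := by
    refine (Real.norm_exp_I_mul_ofReal_sub_one_le).trans_eq ?_
    rw [Real.norm_eq_abs, abs_neg, abs_mul, abs_of_nonneg hy]
  set p := Complex.exp (Complex.I * ((-(t * y) : ℝ) : ℂ))
  -- `v ≥ u/4` gives Gaussian decay `u t²/8`; `|t| ≤ 1/4` gives `‖R‖ ≤ u t²/18`; and `1/8 - 1/18 ≥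
  -- 1/16`.
  have haE : Real.exp a * Real.exp ‖R‖ ≤ E := by
    rw [← Real.exp_add, hE]
    refine Real.exp_le_exp.2 ?_
    have h1 : |t| ^ 3 ≤ 1 / 4 * t ^ 2 := by
      rw [← htt]; nlinarith [sq_nonneg |t|]
    have h2 : |t| ^ 3 * u ≤ 1 / 4 * t ^ 2 * u := mul_le_mul_of_nonneg_right h1 hu0
    have h3 : u / 4 * t ^ 2 ≤ v * t ^ 2 := mul_le_mul_of_nonneg_right hv (sq_nonneg t)
    have h4 : 0 ≤ u * t ^ 2 := mul_nonneg hu0 (sq_nonneg t)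
    rw [ha]
    linarith
  have haE' : Real.exp a ≤ E :=
    (le_mul_of_one_le_right (Real.exp_pos _).le (Real.one_le_exp (norm_nonneg _))).trans haE
  have hRexp : ‖Complex.exp R‖ ≤ Real.exp ‖R‖ := Complex.norm_exp_le_exp_norm R
  have hd : ‖K ^ 2 - (u : ℂ) ^ 2‖ ≤ 2 * u ^ 2 * |t| := by
    rw [sq_sub_sq, norm_mul]
    have h1 : ‖K + u‖ ≤ 2 * u := by
      refine (norm_add_le _ _).trans ?_
      rw [Complex.norm_real, Real.norm_eq_abs, abs_of_nonneg hu0]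
      linarith
    calc ‖K + u‖ * ‖K - u‖ ≤ (2 * u) * (|t| * u) :=
          mul_le_mul h1 (hK1.trans (mul_le_mul_of_nonneg_left hvu ht0)) (norm_nonneg _)
            (by linarith)
      _ = _ := by ring
  have e : K ^ 2 * ((Real.exp a : ℂ) * Complex.exp R * p) - ((u ^ 2 * Real.exp a : ℝ) : ℂ) =
      (K ^ 2 - (u : ℂ) ^ 2) * ((Real.exp a : ℂ) * Complex.exp R * p) +
      (u : ℂ) ^ 2 * ((Real.exp a : ℂ) * ((Complex.exp R - 1) * p + (p - 1))) := by
    push_cast; ring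
  rw [e]
  have hna : ‖(Real.exp a : ℂ)‖ = Real.exp a := by
    rw [Complex.norm_real, Real.norm_eq_abs, Real.abs_exp]
  have b1 : ‖(Real.exp a : ℂ) * Complex.exp R * p‖ ≤ E := by
    rw [norm_mul, norm_mul, hphase, mul_one, hna]
    exact (mul_le_mul_of_nonneg_left hRexp (Real.exp_pos _).le).trans haE
  have b2 : ‖(Real.exp a : ℂ) * ((Complex.exp R - 1) * p + (p - 1))‖ ≤
      E * (2 / 9 * |t| ^ 3 * u) + E * (|t| * y) := by
    rw [norm_mul, hna]
    have h1 : ‖(Complex.exp R - 1) * p + (p - 1)‖ ≤ ‖R‖ * Real.exp ‖R‖ + |t| * y := by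
      refine (norm_add_le _ _).trans (add_le_add ?_ hphase1)
      rw [norm_mul, hphase, mul_one]
      exact norm_cexp_sub_one_le R
    calc Real.exp a * ‖(Complex.exp R - 1) * p + (p - 1)‖
        ≤ Real.exp a * (‖R‖ * Real.exp ‖R‖ + |t| * y) :=
          mul_le_mul_of_nonneg_left h1 (Real.exp_pos _).le
      _ = Real.exp a * Real.exp ‖R‖ * ‖R‖ + Real.exp a * (|t| * y) := by ring
      _ ≤ _ := add_le_add
          (mul_le_mul haE hT (norm_nonneg _) (Real.exp_pos _).le)
          (mul_le_mul_of_nonneg_right haE' (mul_nonneg ht0 hy))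
  have hnu : ‖(u : ℂ) ^ 2‖ = u ^ 2 := by
    rw [norm_pow, Complex.norm_real, Real.norm_eq_abs, sq_abs]
  refine (norm_add_le _ _).trans ?_
  rw [norm_mul, norm_mul ((u : ℂ) ^ 2), hnu]
  have hE0 : 0 < E := Real.exp_pos _
  calc ‖K ^ 2 - (u : ℂ) ^ 2‖ * ‖(Real.exp a : ℂ) * Complex.exp R * p‖ +
        u ^ 2 * ‖(Real.exp a : ℂ) * ((Complex.exp R - 1) * p + (p - 1))‖
      ≤ 2 * u ^ 2 * |t| * E + u ^ 2 * (E * (2 / 9 * |t| ^ 3 * u) + E * (|t| * y)) :=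
        add_le_add (mul_le_mul hd b1 (norm_nonneg _) (by positivity))
          (mul_le_mul_of_nonneg_left b2 (sq_nonneg u))
    _ ≤ _ := by
        have : 0 ≤ u ^ 2 * E * (|t| ^ 3 * u) := by positivity
        nlinarith

theorem norm_inversionIntegrand (ν : Measure ℝ) (β x t : ℝ) :
    ‖inversionIntegrand ν β x t‖ = ‖complexMGF id ν (β + t * Complex.I)‖ ^ 2 *
      ‖Complex.exp (complexCumulant ν (β + t * Complex.I) - complexCumulant ν β)‖ := by
  have h1 : ‖Complex.exp (-(t * x * Complex.I))‖ = 1 := by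
    have := Complex.norm_exp_ofReal_mul_I (-(t * x))
    push_cast at this
    rwa [neg_mul] at this
  rw [inversionIntegrand, sub_eq_add_neg _ (t * x * Complex.I : ℂ), Complex.exp_add, norm_mul,
    norm_mul, h1, mul_one, norm_pow]

theorem IsLevyKernel.integrable_inversionIntegrand (hk : IsLevyKernel k M δ) (β x : ℝ) :
    Integrable (inversionIntegrand (kernelMeasure k) β x) := by
  have := hk.isFiniteMeasure
  have hc1 : Continuous (complexCumulant (kernelMeasure k)) := continuous_iff_continuousAt.2
    fun z => (hasDerivAt_complexCumulant hk.ae_mem z).continuousAt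
  have hc2 : Continuous (complexMGF id (kernelMeasure k)) := continuous_iff_continuousAt.2
    fun z => (hasDerivAt_complexMGF
      (by rw [integrableExpSet_eq_univ hk.ae_mem]; simp)).continuousAt
  refine (hk.integrable_norm_sq_complexMGF β).mono' ?_ (Eventually.of_forall fun t => ?_)
  · refine Continuous.aestronglyMeasurable ?_
    unfold inversionIntegrand
    fun_prop
  · refine (norm_inversionIntegrand _ β x t).trans_le (mul_le_of_le_one_right (sq_nonneg _) ?_)
    rw [Complex.norm_exp, Real.exp_le_one_iff]
    refine (re_complexCumulant_sub_le hk.ae_mem β t).trans (neg_nonpos.2 ?_)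
    exact integral_nonneg fun y =>
      mul_nonneg (by linarith [Real.cos_le_one (t * y)]) (Real.exp_pos _).le

/-- For `|t| ≥ 1/4` the two terms are bounded separately. The Gaussian one is absorbed using `1 ≤
6|t|`, hence the 6 in place of 2. -/
theorem IsLevyKernel.norm_inversionIntegrand_sub_le (hk : IsLevyKernel k M δ) {κ β y : ℝ}
    (hκ : ∀ t : ℝ, 1 / 4 ≤ |t| → ‖Complex.exp (complexCumulant (kernelMeasure k)
      (β + t * Complex.I) - complexCumulant (kernelMeasure k) β)‖ ≤ κ) (hκ0 : 0 ≤ κ) (hy : 0 ≤ y)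
    (hv : expMoment (kernelMeasure k) 0 β / 4 ≤ expMoment (kernelMeasure k) 1 β) (t : ℝ) :
    ‖inversionIntegrand (kernelMeasure k) β (expMoment (kernelMeasure k) 0 β + y) t -
        ((expMoment (kernelMeasure k) 0 β ^ 2 *
          Real.exp (-(expMoment (kernelMeasure k) 1 β / 2 * t ^ 2)) : ℝ) : ℂ)‖ ≤
      expMoment (kernelMeasure k) 0 β ^ 2 *
        (Real.exp (-(1 / 16 * expMoment (kernelMeasure k) 0 β * t ^ 2)) *
        ((6 + y) * |t| + expMoment (kernelMeasure k) 0 β * |t| ^ 3)) +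
      κ * ‖complexMGF id (kernelMeasure k) (β + t * Complex.I)‖ ^ 2 := by
  have := hk.isFiniteMeasure
  have hu0 := expMoment_nonneg hk.ae_mem 0 β
  rcases le_total |t| (1 / 4) with ht | ht
  · refine (norm_inversionIntegrand_sub_le_of_abs_le hk.ae_mem hy hv ht).trans ?_
    refine le_add_of_le_of_nonneg ?_ (by positivity)
    gcongr
    norm_num
  · refine ((norm_sub_le _ _).trans (add_le_add ?_ ?_)).trans_eq (add_comm _ _)
    · refine (norm_inversionIntegrand _ β _ t).trans_le ?_
      rw [mul_comm]
      exact mul_le_mul_of_nonneg_right (hκ t ht) (sq_nonneg _)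
    · rw [Complex.norm_real, Real.norm_eq_abs, abs_of_nonneg (by positivity)]
      refine mul_le_mul_of_nonneg_left ?_ (sq_nonneg _)
      have h1 : Real.exp (-(expMoment (kernelMeasure k) 1 β / 2 * t ^ 2)) ≤
          Real.exp (-(1 / 16 * expMoment (kernelMeasure k) 0 β * t ^ 2)) := by
        refine Real.exp_le_exp.2 ?_
        nlinarith [mul_le_mul_of_nonneg_right hv (sq_nonneg t), mul_nonneg hu0 (sq_nonneg t)]
      refine h1.trans (le_mul_of_one_le_right (Real.exp_pos _).le ?_)
      have : 0 ≤ expMoment (kernelMeasure k) 0 β * |t| ^ 3 := by positivity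
      nlinarith [mul_nonneg hy (abs_nonneg t)]

/-- By scaling, the first and third absolute Gaussian moments are of order `1/u` and `1/u²`, so the
central error is `O(u(1 + y))`. The part `|t| ≥ 1/4` contributes at most 1 for large `β`. -/
theorem IsLevyKernel.exists_norm_integral_inversionIntegrand_sub_le (hk : IsLevyKernel k M δ) :
    ∃ A ≥ 0, ∀ᶠ β in atTop, ∀ y ≥ 0,
      ‖(∫ t, inversionIntegrand (kernelMeasure k) β (expMoment (kernelMeasure k) 0 β + y) t) -
        ((expMoment (kernelMeasure k) 0 β ^ 2 *
          Real.sqrt (Real.pi / (expMoment (kernelMeasure k) 1 β / 2)) : ℝ) : ℂ)‖ ≤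
      A * (expMoment (kernelMeasure k) 0 β * (1 + y)) := by
  have hfin := hk.isFiniteMeasure
  obtain ⟨κ, hκ, hbound⟩ := hk.exists_norm_cexp_le
  set A1 : ℝ := ∫ t : ℝ, Real.exp (-(1 / 16 * t ^ 2)) * |t| ^ 1
  set A3 : ℝ := ∫ t : ℝ, Real.exp (-(1 / 16 * t ^ 2)) * |t| ^ 3
  have hA1 : 0 ≤ A1 := integral_nonneg fun t => by positivity
  have hA3 : 0 ≤ A3 := integral_nonneg fun t => by positivity
  have htail : Tendsto (fun β : ℝ => Real.exp (-(κ * Real.exp (β * (1 - δ)))) *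
      (2 * Real.pi * M ^ 2 * Real.exp (2 * β))) atTop (𝓝 0) :=
    tendsto_exp_neg_exp_mul_exp hκ hk.le_quarter _ (by positivity)
  refine ⟨6 * A1 + A3 + 1, by positivity, ?_⟩
  filter_upwards [eventually_ge_atTop 0, hk.eventually_expMoment_one_ge,
    hk.tendsto_expMoment_zero_atTop.eventually_ge_atTop 1,
    htail.eventually_le_const one_pos] with β hβ hv hu1 hsmall y hy
  set ν := kernelMeasure k
  set u := expMoment ν 0 β
  set v := expMoment ν 1 β
  have hu : 0 < u := by linarith
  have hv0 : 0 < v := by linarith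
  have hg : Integrable fun t : ℝ => u ^ 2 * Real.exp (-(v / 2 * t ^ 2)) := by
    have := integrable_abs_pow_mul_gaussian (b := v / 2) (by linarith) 0
    simp only [pow_zero, mul_one] at this
    exact this.const_mul _
  have hgi : ∫ t : ℝ, ((u ^ 2 * Real.exp (-(v / 2 * t ^ 2)) : ℝ) : ℂ) =
      ((u ^ 2 * Real.sqrt (Real.pi / (v / 2)) : ℝ) : ℂ) := by
    rw [integral_complex_ofReal, integral_const_mul, ← integral_gaussian]
    simp only [neg_mul]
  have hs := Real.sqrt_pos.2 hu
  have hss : Real.sqrt u ^ 2 = u := Real.sq_sqrt hu.le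
  have hi1 := integrable_abs_pow_mul_gaussian (b := 1 / 16 * u) (by positivity) 1
  have hi3 := integrable_abs_pow_mul_gaussian (b := 1 / 16 * u) (by positivity) 3
  have hc1 : ∫ t : ℝ, Real.exp (-(1 / 16 * u * t ^ 2)) * |t| ^ 1 = A1 / u := by
    rw [integral_abs_pow_mul_gaussian hu, hss]
  have hc3 : ∫ t : ℝ, Real.exp (-(1 / 16 * u * t ^ 2)) * |t| ^ 3 = A3 / u ^ 2 := by
    rw [integral_abs_pow_mul_gaussian hu, show 3 + 1 = 2 * 2 by rfl, pow_mul, hss]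
  have hK := hk.integrable_norm_sq_complexMGF β
  have hB : Integrable fun t : ℝ => u ^ 2 * (Real.exp (-(1 / 16 * u * t ^ 2)) *
        ((6 + y) * |t| + u * |t| ^ 3)) := by
    have := ((hi1.const_mul (6 + y)).add (hi3.const_mul u)).const_mul (u ^ 2)
    refine this.congr (Eventually.of_forall fun t => ?_)
    simp only [Pi.add_apply]
    ring
  have hBi : ∫ t : ℝ, u ^ 2 * (Real.exp (-(1 / 16 * u * t ^ 2)) *
        ((6 + y) * |t| + u * |t| ^ 3)) = u * ((6 + y) * A1 + A3) := by
    have : ∀ t : ℝ, u ^ 2 * (Real.exp (-(1 / 16 * u * t ^ 2)) * ((6 + y) * |t| + u * |t| ^ 3)) =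
        u ^ 2 * (6 + y) * (Real.exp (-(1 / 16 * u * t ^ 2)) * |t| ^ 1) +
        u ^ 3 * (Real.exp (-(1 / 16 * u * t ^ 2)) * |t| ^ 3) := fun t => by ring
    simp_rw [this]
    rw [integral_add (hi1.const_mul _) (hi3.const_mul _), integral_const_mul, integral_const_mul,
      hc1, hc3]
    field_simp
  have hF : Integrable fun t => inversionIntegrand ν β (u + y) t :=
    hk.integrable_inversionIntegrand β _
  have hg' : Integrable fun t : ℝ => ((u ^ 2 * Real.exp (-(v / 2 * t ^ 2)) : ℝ) : ℂ) := hg.ofReal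
  rw [← hgi, ← integral_sub hF hg']
  refine (norm_integral_le_of_norm_le (hB.add (hK.const_mul _)) (Eventually.of_forall fun t =>
    hk.norm_inversionIntegrand_sub_le (hbound β · hβ) (Real.exp_pos _).le hy hv t)).trans ?_
  simp only [Pi.add_apply]
  rw [integral_add hB (hK.const_mul _), hBi, integral_const_mul]
  have hlast := (mul_le_mul_of_nonneg_left (hk.integral_norm_sq_complexMGF_le hβ)
    (Real.exp_pos (-(κ * Real.exp (β * (1 - δ))))).le).trans hsmall
  have h1 : 1 ≤ u * (1 + y) := by nlinarith
  calc _ ≤ u * ((6 + y) * A1 + A3) + 1 := add_le_add le_rfl hlast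
    _ ≤ _ := by nlinarith [mul_nonneg hu.le (mul_nonneg hy hA1), mul_nonneg hu.le (mul_nonneg hy hA3)]

end Estimate

end LevyTail

/-! ### From the inversion integral to the density and the tail. -/

namespace LevyTail

open MeasureTheory Filter Topology FourierTransform SchwartzMap
open scoped Convolution ENNReal ContDiff

open ProbabilityTheory

section Asymptotics

variable {k : ℝ → ℝ} {M δ : ℝ} {μ : Measure ℝ} [IsProbabilityMeasure μ] {f : ℝ → ℝ}

/-- The cumulant generating function `∫ (e^{θ x} - 1) / x dν(x)`. -/
noncomputable def realCumulant (ν : Measure ℝ) (θ : ℝ) : ℝ := ∫ x, (Real.exp (θ * x) - 1) / x ∂ν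

/-- The prefactor `1 / (√(2π) σ)` with `σ² = ∫ x e^{β x} dν(x)`. -/
noncomputable def gaussianPeak (ν : Measure ℝ) (β : ℝ) : ℝ :=
  1 / (Real.sqrt (2 * Real.pi) * Real.sqrt (expMoment ν 1 β))

theorem IsLevyLaw.exists_convDensityTwo_bound (h : IsLevyLaw μ k) (hk : IsLevyKernel k M δ) :
    ∃ A ≥ 0, ∀ᶠ β in atTop, ∀ y ≥ 0,
      |Real.exp (β * (expMoment (kernelMeasure k) 0 β + y) - realCumulant (kernelMeasure k) β) *
          convDensityTwo k μ (expMoment (kernelMeasure k) 0 β + y) -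
        expMoment (kernelMeasure k) 0 β ^ 2 * gaussianPeak (kernelMeasure k) β| ≤
      A * (expMoment (kernelMeasure k) 0 β * (1 + y)) := by
  obtain ⟨A, hA, hev⟩ := hk.exists_norm_integral_inversionIntegrand_sub_le
  refine ⟨(2 * Real.pi)⁻¹ * A, by positivity, hev.mono fun β hβ y hy => ?_⟩
  have hb := hβ y hy
  set u := expMoment (kernelMeasure k) 0 β
  set v := expMoment (kernelMeasure k) 1 β with hv
  have hv0 : 0 < v := hk.expMoment_one_pos β
  have e1 : ((Real.exp (β * (u + y) - realCumulant (kernelMeasure k) β) *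
      convDensityTwo k μ (u + y) : ℝ) : ℂ) =
      (2 * Real.pi)⁻¹ * ∫ t, inversionIntegrand (kernelMeasure k) β (u + y) t := by
    have h1 := h.exp_mul_convDensityTwo_eq hk β (u + y)
    have h2 : complexCumulant (kernelMeasure k) β = realCumulant (kernelMeasure k) β :=
      complexCumulant_ofReal β
    rw [sub_eq_add_neg, Real.exp_add, mul_right_comm, Complex.ofReal_mul, h1, mul_assoc,
      ← integral_mul_const]
    congr 1
    refine integral_congr_ae (Eventually.of_forall fun t => ?_)
    simp only [inversionIntegrand, h2]
    rw [mul_assoc, Complex.ofReal_exp, ← Complex.exp_add]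
    push_cast
    ring_nf
  have e2 : u ^ 2 * gaussianPeak (kernelMeasure k) β =
      (2 * Real.pi)⁻¹ * (u ^ 2 * Real.sqrt (Real.pi / (v / 2))) := by
    have h3 : Real.sqrt (Real.pi / (v / 2)) = Real.sqrt (2 * Real.pi) / Real.sqrt v := by
      rw [← Real.sqrt_div (by positivity)]; congr 1; field_simp
    have h4 : Real.sqrt (2 * Real.pi) ^ 2 = 2 * Real.pi := Real.sq_sqrt (by positivity)
    have h5 : 0 < Real.sqrt (2 * Real.pi) := by positivity
    have h6 : 0 < Real.sqrt v := by positivity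
    have h7 : (2 * Real.pi)⁻¹ = (Real.sqrt (2 * Real.pi) ^ 2)⁻¹ := by rw [h4]
    rw [gaussianPeak, ← hv, h3, h7]
    field_simp
  rw [← Real.norm_eq_abs, ← Complex.norm_real, Complex.ofReal_sub, e1, e2, Complex.ofReal_mul, ← mul_sub,
    norm_mul, Complex.norm_real, Real.norm_eq_abs, abs_of_pos (by positivity), mul_assoc]
  exact mul_le_mul_of_nonneg_left hb (by positivity)

/-- Undoes the double size-bias: `F` is `G` divided by a factor between `(u + y - 1)(u + y)` and `(u
+ y)²`, and replacing that factor by `u²` costs only `O((1 + y)/u)` since `s ≤ 1`. -/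
theorem abs_sub_le_of_mul_bounds {A u y s F G : ℝ} (hA : 0 ≤ A) (hu : 4 ≤ u) (hy : 0 ≤ y) (hs : s ≤ 1)
    (hG0 : 0 ≤ G) (hG : |G - u ^ 2 * s| ≤ A * (u * (1 + y)))
    (h1 : G ≤ (u + y) * ((u + y) * F)) (h2 : (u + y - 1) * ((u + y) * F) ≤ G) :
    |F - s| ≤ (2 + 2 * A) * ((1 + y) / u) := by
  obtain ⟨hG1, hG2⟩ := abs_le.1 hG
  have hF0 : 0 ≤ F := by
    have : 0 ≤ (u + y) * ((u + y) * F) := hG0.trans h1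
    rw [← mul_assoc] at this
    exact nonneg_of_mul_nonneg_right this (by positivity)
  have hu0 : 0 < u := by linarith
  rw [abs_le]
  constructor
  · have key : (s - F) * (u + y) ^ 2 ≤ (2 + 2 * A) * (1 + y) / u * (u + y) ^ 2 := by
      have e1 : (s - F) * (u + y) ^ 2 ≤ s * (2 * u * y + y ^ 2) + A * (u * (1 + y)) := by nlinarith
      have e2 : s * (2 * u * y + y ^ 2) ≤ 2 * u * y + y ^ 2 :=
        mul_le_of_le_one_left (by positivity) hs
      have e3 : (2 + 2 * A) * (1 + y) / u * (u + y) ^ 2 =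
          (2 + 2 * A) * (1 + y) * (u + 2 * y + y ^ 2 / u) := by field_simp; ring
      have e4 : 0 ≤ y ^ 2 / u := by positivity
      have e5 : 2 * u * y + y ^ 2 + A * (u * (1 + y)) ≤
          (2 + 2 * A) * (1 + y) * (u + 2 * y) := by
        nlinarith [mul_nonneg hA hu0.le, mul_nonneg hA hy, mul_nonneg (mul_nonneg hA hu0.le) hy,
          mul_nonneg (mul_nonneg hA hy) hy, mul_nonneg hu0.le hy]
      have e6 : 0 ≤ (2 + 2 * A) * (1 + y) * (y ^ 2 / u) := by positivity
      rw [e3]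
      nlinarith
    have := le_of_mul_le_mul_right key (by positivity)
    rw [mul_div_assoc] at this
    linarith
  · have key : (F - s) * (u * (u - 1)) ≤ (2 + 2 * A) * ((1 + y) / u) * (u * (u - 1)) := by
      have e0 : u * (u - 1) ≤ (u + y - 1) * (u + y) := by nlinarith
      have e1 : F * (u * (u - 1)) ≤ G := by nlinarith [mul_le_mul_of_nonneg_left e0 hF0]
      have e3 : (2 + 2 * A) * ((1 + y) / u) * (u * (u - 1)) =
          (2 + 2 * A) * (1 + y) * (u - 1) := by field_simp
      have e4 : s * u ≤ u := mul_le_of_le_one_left hu0.le hs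
      rw [e3]
      nlinarith [mul_nonneg hA hy, mul_nonneg (mul_nonneg hA hy) hu0.le]
    exact le_of_mul_le_mul_right key (by nlinarith)

theorem IsLevyKernel.gaussianPeak_pos (hk : IsLevyKernel k M δ) (β : ℝ) :
    0 < gaussianPeak (kernelMeasure k) β := by
  have := hk.expMoment_one_pos β
  unfold gaussianPeak
  positivity

/-- Local limit estimate for the exponentially tilted density to the right of its mean. -/
theorem IsDefectiveDensity.exists_tilted_bound (hf : IsDefectiveDensity μ f) (h : IsLevyLaw μ k)
    (hk : IsLevyKernel k M δ) (hc : ContinuousOn f (Set.Ioi 1)) :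
    ∃ A ≥ 0, ∀ᶠ β in atTop, ∀ y ≥ 0,
      |Real.exp (β * (expMoment (kernelMeasure k) 0 β + y) - realCumulant (kernelMeasure k) β) *
          f (expMoment (kernelMeasure k) 0 β + y) - gaussianPeak (kernelMeasure k) β| ≤
      A * ((1 + y) / expMoment (kernelMeasure k) 0 β) := by
  obtain ⟨A, hA, hev⟩ := h.exists_convDensityTwo_bound hk
  refine ⟨2 + 2 * A, by positivity, ?_⟩
  filter_upwards [hev, hk.eventually_expMoment_one_ge,
    hk.tendsto_expMoment_zero_atTop.eventually_ge_atTop 4] with β hb hv hu y hy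
  have hs : gaussianPeak (kernelMeasure k) β ≤ 1 := by
    have h1 : 1 ≤ Real.sqrt (expMoment (kernelMeasure k) 1 β) := Real.one_le_sqrt.2 (by linarith)
    have h2 : 1 ≤ Real.sqrt (2 * Real.pi) := Real.one_le_sqrt.2 (by linarith [Real.pi_gt_three])
    unfold gaussianPeak
    rw [div_le_one (by positivity)]
    nlinarith
  set u := expMoment (kernelMeasure k) 0 β
  obtain ⟨b1, b2⟩ := hf.mul_bounds h hk hc (x := u + y) (by linarith)
  set e := Real.exp (β * (u + y) - realCumulant (kernelMeasure k) β)
  have he : 0 < e := Real.exp_pos _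
  refine abs_sub_le_of_mul_bounds hA hu hy hs
    (mul_nonneg he.le (hk.convDensityTwo_nonneg _)) (hb y hy) ?_ ?_
  · nlinarith [mul_le_mul_of_nonneg_left b1 he.le]
  · nlinarith [mul_le_mul_of_nonneg_left b2 he.le]

theorem IsDefectiveDensity.measureReal_Ici (hf : IsDefectiveDensity μ f) {u : ℝ} (hu : 0 < u) :
    μ.real (Set.Ici u) = ∫ y in Set.Ioi 0, f (u + y) := by
  have h1 : μ (Set.Ici u) = ∫⁻ x in Set.Ici u, ENNReal.ofReal (f x) := by
    conv_lhs => rw [hf.2.2]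
    rw [Measure.add_apply, Measure.smul_apply, withDensity_apply _ measurableSet_Ici,
      Measure.dirac_apply' _ measurableSet_Ici, Set.indicator_of_notMem (by simpa using hu)]
    simp
  have h2 : ∫ y in Set.Ioi 0, f (u + y) = ∫ x in Set.Ici u, f x := by
    rw [integral_Ici_eq_integral_Ioi]
    have := (measurePreserving_add_left volume u).setIntegral_preimage_emb
      (measurableEmbedding_addLeft u) f (Set.Ioi u)
    simpa using this
  rw [h2, Measure.real, h1, ← ofReal_integral_eq_lintegral_ofReal hf.integrable.integrableOn
    (Eventually.of_forall hf.2.1), ENNReal.toReal_ofReal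
    (integral_nonneg hf.2.1)]

/-- Integrate the local estimate in `y` against `e^{-βy}`, with `β` fixed. Bounding `1 + y` by `e^y`
turns the error integral into `1/(β - 1)`, which is at most `2/β` for `β ≥ 2`. -/
theorem IsDefectiveDensity.exists_tail_bound (hf : IsDefectiveDensity μ f) (h : IsLevyLaw μ k)
    (hk : IsLevyKernel k M δ) (hc : ContinuousOn f (Set.Ioi 1)) :
    ∃ A ≥ 0, ∀ᶠ β in atTop,
      |Real.exp (β * expMoment (kernelMeasure k) 0 β - realCumulant (kernelMeasure k) β) *
          μ.real (Set.Ici (expMoment (kernelMeasure k) 0 β)) -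
        gaussianPeak (kernelMeasure k) β / β| ≤
      A * (1 / expMoment (kernelMeasure k) 0 β / β) := by
  obtain ⟨A, hA, hev⟩ := hf.exists_tilted_bound h hk hc
  refine ⟨2 * A, by positivity, ?_⟩
  filter_upwards [hev, eventually_ge_atTop 2,
    hk.tendsto_expMoment_zero_atTop.eventually_ge_atTop 1] with β hb hβ hu
  set u := expMoment (kernelMeasure k) 0 β
  set s := gaussianPeak (kernelMeasure k) β
  set C := realCumulant (kernelMeasure k) β
  have hu0 : 0 < u := by linarith
  have hexp : ∀ b : ℝ, 0 < b → IntegrableOn (fun y => Real.exp (-b * y)) (Set.Ioi 0) ∧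
      ∫ y in Set.Ioi 0, Real.exp (-b * y) = 1 / b := fun b hb0 => by
    refine ⟨integrableOn_exp_mul_Ioi (by linarith) 0, ?_⟩
    rw [integral_exp_mul_Ioi (by linarith)]
    simp
  obtain ⟨i1, j1⟩ := hexp β (by linarith)
  obtain ⟨i2, j2⟩ := hexp (β - 1) (by linarith)
  have hif : IntegrableOn (fun y => Real.exp (β * u - C) * f (u + y)) (Set.Ioi 0) :=
    ((hf.integrable.comp_add_left u).const_mul _).integrableOn
  rw [hf.measureReal_Ici hu0, ← integral_const_mul,
    show s / β = ∫ y in Set.Ioi 0, s * Real.exp (-β * y) by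
      rw [integral_const_mul, j1]; ring,
    ← integral_sub hif (i1.const_mul s), ← Real.norm_eq_abs]
  refine (norm_integral_le_of_norm_le (i2.const_mul (A / u)) ?_).trans ?_
  · rw [ae_restrict_iff' measurableSet_Ioi]
    refine Eventually.of_forall fun y hy => ?_
    have hy0 : (0 : ℝ) ≤ y := le_of_lt hy
    have e1 : Real.exp (β * u - C) * f (u + y) - s * Real.exp (-β * y) =
        Real.exp (-β * y) * (Real.exp (β * (u + y) - C) * f (u + y) - s) := by
      have : Real.exp (β * u - C) = Real.exp (-β * y) * Real.exp (β * (u + y) - C) := by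
        rw [← Real.exp_add]; ring_nf
      rw [this]; ring
    rw [e1, Real.norm_eq_abs, abs_mul, Real.abs_exp]
    have e2 : Real.exp (-(β - 1) * y) = Real.exp (-β * y) * Real.exp y := by
      rw [← Real.exp_add]; ring_nf
    rw [e2]
    calc _ ≤ Real.exp (-β * y) * (A * ((1 + y) / u)) :=
          mul_le_mul_of_nonneg_left (hb y hy0) (Real.exp_pos _).le
      _ ≤ Real.exp (-β * y) * (A * (Real.exp y / u)) := by
          have := Real.add_one_le_exp y
          gcongr
          linarith
      _ = _ := by ring
  · rw [integral_const_mul, j2]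
    have : 1 / (β - 1) ≤ 2 * (1 / β) := by
      rw [mul_one_div, div_le_div_iff₀ (by linarith) (by linarith)]; linarith
    calc A / u * (1 / (β - 1)) ≤ A / u * (2 * (1 / β)) :=
          mul_le_mul_of_nonneg_left this (by positivity)
      _ = _ := by ring

/-- As `v ≤ u`, `1/u ≤ 1/√(uv)`. This turns the absolute error `O(1/u)` into an error `O(1/√u)`
relative to the peak. -/
theorem IsLevyKernel.one_div_expMoment_le (hk : IsLevyKernel k M δ) {β : ℝ}
    (hu : 0 < expMoment (kernelMeasure k) 0 β) :
    1 / expMoment (kernelMeasure k) 0 β ≤ Real.sqrt (2 * Real.pi) *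
      (1 / Real.sqrt (expMoment (kernelMeasure k) 0 β)) * gaussianPeak (kernelMeasure k) β := by
  have := hk.isFiniteMeasure
  have h1 : Real.sqrt (expMoment (kernelMeasure k) 1 β) ≤
      Real.sqrt (expMoment (kernelMeasure k) 0 β) :=
    Real.sqrt_le_sqrt (expMoment_succ_le hk.ae_mem 0 β)
  have h2 : 0 < Real.sqrt (expMoment (kernelMeasure k) 1 β) :=
    Real.sqrt_pos.2 (hk.expMoment_one_pos β)
  have h3 := Real.sqrt_pos.2 hu
  have h4 : 0 < Real.sqrt (2 * Real.pi) := by positivity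
  have e : Real.sqrt (2 * Real.pi) * (1 / Real.sqrt (expMoment (kernelMeasure k) 0 β)) *
      gaussianPeak (kernelMeasure k) β = 1 / (Real.sqrt (expMoment (kernelMeasure k) 0 β) *
        Real.sqrt (expMoment (kernelMeasure k) 1 β)) := by
    unfold gaussianPeak
    field_simp
  rw [e]
  refine one_div_le_one_div_of_le (by positivity) ?_
  calc _ ≤ _ := mul_le_mul_of_nonneg_left h1 h3.le
    _ = _ := Real.mul_self_sqrt hu.le

end Asymptotics

/-! ### Calculus of relative errors. -/

section RelError

theorem EqWithRelError.of_abs_sub_le {F G r : ℝ → ℝ} (B : ℝ)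
    (h : ∀ᶠ u in atTop, G u ≠ 0 ∧ |F u - G u| ≤ B * |r u| * |G u|) : EqWithRelError F G r := by
  refine ⟨fun u => F u / G u - 1, Asymptotics.IsBigO.of_bound B (h.mono fun u hu => ?_),
    h.mono fun u hu => ?_⟩
  · have hG := abs_pos.2 hu.1
    rw [Real.norm_eq_abs, Real.norm_eq_abs, div_sub_one hu.1, abs_div, div_le_iff₀ hG]
    exact hu.2
  · have := hu.1
    field_simp
    ring

/-- The new relative error is `(R₂ - R₁)/(1 + R₁)`, and the denominator tends to 1. -/
theorem EqWithRelError.div_trans {f p S b r : ℝ → ℝ} (hr : Tendsto r atTop (𝓝 0))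
    (hf : EqWithRelError f S r) (hp : EqWithRelError p (fun u => 1 / b u * S u) r) :
    EqWithRelError p (fun u => f u / b u) r := by
  obtain ⟨R1, hR1, e1⟩ := hf
  obtain ⟨R2, hR2, e2⟩ := hp
  have h0 : Tendsto (fun u => 1 + R1 u) atTop (𝓝 1) := by
    simpa using (hR1.trans_tendsto hr).const_add 1
  have hinv : (fun u => (1 + R1 u)⁻¹) =O[atTop] fun _ => (1 : ℝ) :=
    (h0.inv₀ one_ne_zero).isBigO_one ℝ
  refine ⟨fun u => (R2 u - R1 u) * (1 + R1 u)⁻¹, ?_, ?_⟩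
  · simpa using (hR2.sub hR1).mul hinv
  · filter_upwards [e1, e2, h0.eventually_ne one_ne_zero] with u h1 h2 h3
    rw [h2, h1]
    field_simp
    ring

end RelError

end LevyTail

/-! ### From the Lévy density `g` to a kernel, and the asymptotics at the saddle point. -/

namespace LevyTail

open MeasureTheory Filter Topology FourierTransform SchwartzMap
open scoped Convolution ENNReal ContDiff

open ProbabilityTheory

/-- The function `x g(x)` on `(0, 1]` agrees almost everywhere with a Lévy kernel. -/
theorem exists_isLevyKernel {g : ℝ → ℝ}
    (hg_meas : AEMeasurable g (volume.restrict (Set.Ioc (0 : ℝ) 1)))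
    (hg_nonneg : ∀ x ∈ Set.Ioc (0 : ℝ) 1, 0 ≤ g x)
    (hg_sup : BddAbove ((fun x : ℝ => x * g x) '' Set.Ioc (0 : ℝ) 1)) {ε : ℝ} (hε : 0 < ε)
    (hg_ge : ∀ x ∈ Set.Ioc (0 : ℝ) 1, 1 - ε ≤ x → ε ≤ g x) :
    ∃ (k : ℝ → ℝ) (M δ : ℝ), IsLevyKernel k M δ ∧
      ∀ᵐ x ∂(volume.restrict (Set.Ioc (0 : ℝ) 1)), k x = x * g x := by
  obtain ⟨M₀, hM₀⟩ := hg_sup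
  -- On `[1 - δ, 1]` one has `x ≥ 3/4` and `g ≥ ε`, so `x g(x) ≥ δ`.
  set δ : ℝ := min (ε / 2) (1 / 4) with hδ
  have hδ0 : 0 < δ := by positivity
  have hδ1 : δ ≤ ε / 2 := min_le_left _ _
  have hδ2 : δ ≤ 1 / 4 := min_le_right _ _
  set M : ℝ := max M₀ δ
  let l : ℝ → ℝ := (Set.Icc (1 - δ) 1).indicator fun _ => δ
  have hl0 : ∀ x, 0 ≤ l x := fun x => Set.indicator_nonneg (fun _ _ => hδ0.le) x
  have hl : ∀ x, l x ≤ δ := fun x => Set.indicator_le_self' (fun _ _ => hδ0.le) x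
  -- Clipping a measurable version of `x g(x)` makes the kernel bounds hold everywhere, while
  -- changing it only on a null set of `(0, 1]`.
  let k : ℝ → ℝ := (Set.Ioc (0 : ℝ) 1).indicator fun x => max (l x) (min M (x * hg_meas.mk g x))
  have hmk := hg_meas.measurable_mk
  have hlm : Measurable l := measurable_const.indicator measurableSet_Icc
  refine ⟨k, M, δ, ⟨?_, ?_, ?_, fun x hx => Set.indicator_of_notMem hx _, hδ0, hδ2, ?_⟩, ?_⟩
  · exact (hlm.max (measurable_const.min (measurable_id.mul hmk))).indicator measurableSet_Ioc
  · exact fun x => Set.indicator_nonneg (fun x _ => (hl0 x).trans (le_max_left _ _)) x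
  · exact fun x => Set.indicator_apply_le' (fun _ => max_le ((hl x).trans (le_max_right _ _))
      (min_le_left _ _)) fun _ => hδ0.le.trans (le_max_right _ _)
  · intro x hx
    have hx' : x ∈ Set.Ioc (0 : ℝ) 1 := ⟨by linarith [hx.1], hx.2⟩
    simp only [k, Set.indicator_of_mem hx']
    refine le_trans ?_ (le_max_left _ _)
    simp [l, Set.indicator_of_mem hx]
  · filter_upwards [hg_meas.ae_eq_mk, ae_restrict_mem measurableSet_Ioc] with x hx hx'
    simp only [k, Set.indicator_of_mem hx']
    rw [← hx, min_eq_right ((hM₀ ⟨x, hx', rfl⟩).trans (le_max_left _ _)), max_eq_right]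
    by_cases h : x ∈ Set.Icc (1 - δ) 1
    · simp only [l, Set.indicator_of_mem h]
      have := hg_ge x hx' (by linarith [h.1])
      nlinarith [h.1]
    · simp only [l, Set.indicator_of_notMem h]
      exact mul_nonneg hx'.1.le (hg_nonneg x hx')

variable {k : ℝ → ℝ} {M δ : ℝ}

theorem IsLevyKernel.cumulant_eq (hk : IsLevyKernel k M δ) {g : ℝ → ℝ}
    (hg : ∀ᵐ x ∂(volume.restrict (Set.Ioc (0 : ℝ) 1)), k x = x * g x) :
    cumulant g = realCumulant (kernelMeasure k) := by
  ext θ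
  rw [realCumulant, hk.integral_eq, cumulant,
    ← setIntegral_eq_integral_of_forall_compl_eq_zero (s := Set.Ioc (0 : ℝ) 1)
      (f := fun x => k x • ((Real.exp (θ * x) - 1) / x))
      (fun x hx => by rw [hk.eq_zero x hx, zero_smul])]
  refine integral_congr_ae ?_
  filter_upwards [hg, ae_restrict_mem measurableSet_Ioc] with x hx hx'
  have := hx'.1.ne'
  rw [hx, smul_eq_mul]
  field_simp

theorem IsLevyKernel.deriv_realCumulant (hk : IsLevyKernel k M δ) :
    deriv (realCumulant (kernelMeasure k)) = expMoment (kernelMeasure k) 0 := by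
  have := hk.isFiniteMeasure
  ext β
  have h := (hasDerivAt_complexCumulant hk.ae_mem (β : ℂ)).real_of_complex
  rw [complexMGF_ofReal_eq_expMoment, Complex.ofReal_re] at h
  refine HasDerivAt.deriv (h.congr_of_eventuallyEq (Eventually.of_forall fun θ => ?_))
  beta_reduce
  rw [complexCumulant_ofReal, Complex.ofReal_re, realCumulant]

theorem IsLevyKernel.deriv_expMoment (hk : IsLevyKernel k M δ) :
    deriv (expMoment (kernelMeasure k) 0) = expMoment (kernelMeasure k) 1 := by
  have := hk.isFiniteMeasure
  exact funext fun β => (hasDerivAt_expMoment hk.ae_mem 0 β).deriv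

/-- The exact solution of the saddle point equation tends to infinity. -/
theorem IsLevyKernel.tendsto_saddlePoint (hk : IsLevyKernel k M δ) {β : ℝ → ℝ}
    (hβ : ∀ u : ℝ, 0 < u → expMoment (kernelMeasure k) 0 (β u) = u) :
    Tendsto β atTop atTop := by
  refine tendsto_atTop.2 fun B => ?_
  filter_upwards [eventually_gt_atTop 0,
    eventually_ge_atTop (expMoment (kernelMeasure k) 0 B)] with u hu hB
  rw [← hβ u hu] at hB
  exact hk.strictMono_expMoment_zero.le_iff_le.1 hB

theorem IsLevyKernel.saddle_eq (hk : IsLevyKernel k M δ) {g : ℝ → ℝ}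
    (hg : ∀ᵐ x ∂(volume.restrict (Set.Ioc (0 : ℝ) 1)), k x = x * g x) (β u : ℝ) :
    saddle g β u =
      Real.exp (realCumulant (kernelMeasure k) β - β * u) * gaussianPeak (kernelMeasure k) β := by
  rw [saddle, hk.cumulant_eq hg, hk.deriv_realCumulant, hk.deriv_expMoment, gaussianPeak,
    mul_one_div, mul_comm u]

variable {μ : Measure ℝ} [IsProbabilityMeasure μ] {f : ℝ → ℝ}

theorem IsDefectiveDensity.eqWithRelError_saddle (hf : IsDefectiveDensity μ f)
    (h : IsLevyLaw μ k) (hk : IsLevyKernel k M δ) (hc : ContinuousOn f (Set.Ioi 1)) {β : ℝ → ℝ}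
    (hβ : ∀ u : ℝ, 0 < u → expMoment (kernelMeasure k) 0 (β u) = u) :
    EqWithRelError f (fun u => Real.exp (realCumulant (kernelMeasure k) (β u) - β u * u) *
      gaussianPeak (kernelMeasure k) (β u)) (fun u => 1 / Real.sqrt u) := by
  obtain ⟨A, hA, hev⟩ := hf.exists_tilted_bound h hk hc
  refine EqWithRelError.of_abs_sub_le (A * Real.sqrt (2 * Real.pi)) ?_
  filter_upwards [(hk.tendsto_saddlePoint hβ).eventually hev, eventually_gt_atTop 0] with u hu hu0
  have h1 := hu 0 le_rfl
  have h2 := hk.one_div_expMoment_le (β := β u) (by rwa [hβ u hu0])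
  rw [hβ u hu0] at h1 h2
  simp only [add_zero] at h1
  have hs := hk.gaussianPeak_pos (β u)
  set s := gaussianPeak (kernelMeasure k) (β u)
  set C := realCumulant (kernelMeasure k) (β u)
  have he := Real.exp_pos (C - β u * u)
  refine ⟨by positivity, ?_⟩
  have e1 : f u - Real.exp (C - β u * u) * s =
      Real.exp (C - β u * u) * (Real.exp (β u * u - C) * f u - s) := by
    rw [mul_sub, ← mul_assoc, ← Real.exp_add]
    simp
  rw [e1, abs_mul, abs_of_pos he, abs_of_pos (by positivity : 0 < 1 / Real.sqrt u),
    abs_of_pos (mul_pos he hs)]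
  calc _ ≤ Real.exp (C - β u * u) * (A * (1 / u)) := mul_le_mul_of_nonneg_left h1 he.le
    _ ≤ Real.exp (C - β u * u) * (A * (Real.sqrt (2 * Real.pi) * (1 / Real.sqrt u) * s)) := by
        gcongr
    _ = _ := by ring

theorem IsDefectiveDensity.tail_eqWithRelError_saddle (hf : IsDefectiveDensity μ f)
    (h : IsLevyLaw μ k) (hk : IsLevyKernel k M δ) (hc : ContinuousOn f (Set.Ioi 1)) {β : ℝ → ℝ}
    (hβ : ∀ u : ℝ, 0 < u → expMoment (kernelMeasure k) 0 (β u) = u) :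
    EqWithRelError (fun u => μ.real (Set.Ici u)) (fun u => 1 / β u *
      (Real.exp (realCumulant (kernelMeasure k) (β u) - β u * u) *
        gaussianPeak (kernelMeasure k) (β u))) (fun u => 1 / Real.sqrt u) := by
  obtain ⟨A, hA, hev⟩ := hf.exists_tail_bound h hk hc
  refine EqWithRelError.of_abs_sub_le (A * Real.sqrt (2 * Real.pi)) ?_
  have hβt := hk.tendsto_saddlePoint hβ
  filter_upwards [hβt.eventually hev, eventually_gt_atTop 0, hβt.eventually_gt_atTop 0]
    with u h1 hu0 hβ0
  have h2 := hk.one_div_expMoment_le (β := β u) (by rwa [hβ u hu0])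
  rw [hβ u hu0] at h1 h2
  have hs := hk.gaussianPeak_pos (β u)
  set s := gaussianPeak (kernelMeasure k) (β u)
  set C := realCumulant (kernelMeasure k) (β u)
  have he := Real.exp_pos (C - β u * u)
  refine ⟨by positivity, ?_⟩
  have e1 : μ.real (Set.Ici u) - 1 / β u * (Real.exp (C - β u * u) * s) =
      Real.exp (C - β u * u) * (Real.exp (β u * u - C) * μ.real (Set.Ici u) - s / β u) := by
    rw [mul_sub, ← mul_assoc (Real.exp _) (Real.exp _), ← Real.exp_add, sub_add_sub_cancel,
      sub_self, Real.exp_zero]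
    ring
  rw [e1, abs_mul, abs_of_pos he, abs_of_pos (by positivity : 0 < 1 / Real.sqrt u),
    abs_of_pos (mul_pos (one_div_pos.2 hβ0) (mul_pos he hs))]
  calc _ ≤ Real.exp (C - β u * u) * (A * (1 / u / β u)) := mul_le_mul_of_nonneg_left h1 he.le
    _ ≤ Real.exp (C - β u * u) *
        (A * (Real.sqrt (2 * Real.pi) * (1 / Real.sqrt u) * s / β u)) := by
        gcongr
    _ = _ := by ring

end LevyTail

/-! ### Assembly of the main theorem. -/

theorem mainTheorem3
    {Ω : Type*} [MeasurableSpace Ω] (P : MeasureTheory.Measure Ω)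
    [MeasureTheory.IsProbabilityMeasure P] (T : Ω → ℝ) (hT : AEMeasurable T P)
    (g : ℝ → ℝ)
    (hg_meas : AEMeasurable g (MeasureTheory.volume.restrict (Set.Ioc (0 : ℝ) 1)))
    (hg_nonneg : ∀ x ∈ Set.Ioc (0 : ℝ) 1, 0 ≤ g x)
    (a : ℝ) (ha_pos : 0 < a) (ha_le : a ≤ 1 / 4)
    (hg_pw : LevyTail.PiecewiseContDiff 2 g a 1)
    (hg_sup : BddAbove ((fun x : ℝ => x * g x) '' Set.Ioc (0 : ℝ) 1))
    (ε : ℝ) (hε : 0 < ε)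
    (hg_ge : ∀ x ∈ Set.Ioc (0 : ℝ) 1, 1 - ε ≤ x → ε ≤ g x)
    (hLevy : LevyTail.HasLevyDensity T P g) :
    -- for every `u > 0` the equation `C'(b) = u` has exactly one solution
    (∀ u : ℝ, 0 < u → ∃! b : ℝ, deriv (LevyTail.cumulant g) b = u) ∧
    -- the law of `T` has a (possibly defective) density, with a version continuous on `(1, ∞)`
    (∃ f : ℝ → ℝ, LevyTail.IsDefectiveDensity (P.map T) f ∧ ContinuousOn f (Set.Ioi 1)) ∧
    -- the asymptotic formulas
    ∀ f : ℝ → ℝ, LevyTail.IsDefectiveDensity (P.map T) f → ContinuousOn f (Set.Ioi 1) →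
    ∀ β : ℝ → ℝ, (∀ u : ℝ, 0 < u → deriv (LevyTail.cumulant g) (β u) = u) →
      LevyTail.EqWithRelError f
        (fun u => LevyTail.saddle g (β u) u) (fun u => 1 / Real.sqrt u) ∧
      LevyTail.EqWithRelError (fun u => P.real {ω | u ≤ T ω})
        (fun u => 1 / β u * LevyTail.saddle g (β u) u) (fun u => 1 / Real.sqrt u) ∧
      LevyTail.EqWithRelError (fun u => P.real {ω | u ≤ T ω})
        (fun u => f u / β u) (fun u => 1 / Real.sqrt u) := by
  obtain ⟨k, M, δ, hk, hkg⟩ :=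
    LevyTail.exists_isLevyKernel hg_meas hg_nonneg hg_sup hε hg_ge
  have hcum := hk.cumulant_eq hkg
  have hderiv : deriv (LevyTail.cumulant g) =
      LevyTail.expMoment (LevyTail.kernelMeasure k) 0 := by
    rw [hcum, hk.deriv_realCumulant]
  have : MeasureTheory.IsProbabilityMeasure (P.map T) :=
    MeasureTheory.Measure.isProbabilityMeasure_map hT
  have hlaw : LevyTail.IsLevyLaw (P.map T) k := fun θ => by
    rw [ProbabilityTheory.mgf_id_map hT, hLevy θ, hcum, LevyTail.realCumulant]
  refine ⟨fun u hu => ?_, ⟨_, hlaw.exists_isDefectiveDensity hk, ?_⟩, fun f hf hc β hβ => ?_⟩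
  · rw [hderiv]
    exact hk.existsUnique_expMoment_zero_eq hu
  -- A bootstrap: the existence of some integrable density already makes `convDensity` continuous on
  -- `(1, ∞)`, and hence the explicit density too.
  · have hcont := (hlaw.exists_isDefectiveDensity hk).continuousOn_convDensity hk
    refine (hcont.div continuousOn_id fun x hx => ?_).congr fun x hx => ?_
    · exact (zero_lt_one.trans (Set.mem_Ioi.1 hx)).ne'
    · exact Set.indicator_of_mem (zero_lt_one.trans (Set.mem_Ioi.1 hx)) _
  · rw [hderiv] at hβ
    have h1 := hf.eqWithRelError_saddle hlaw hk hc hβ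
    have h2 := hf.tail_eqWithRelError_saddle hlaw hk hc hβ
    have htail : ∀ u : ℝ, (P.map T).real (Set.Ici u) = P.real {ω | u ≤ T ω} := fun u => by
      rw [MeasureTheory.Measure.real, MeasureTheory.Measure.map_apply_of_aemeasurable hT
        measurableSet_Ici]
      rfl
    simp_rw [htail] at h2
    simp_rw [hk.saddle_eq hkg]
    refine ⟨h1, h2, LevyTail.EqWithRelError.div_trans ?_ h1 h2⟩
    simp only [one_div]
    exact Real.tendsto_sqrt_atTop.inv_tendsto_atTop
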